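/- Let $G$ be a nontrivial homogeneous group, i.e. a simply connected nilpotent real Lie group together with a continuous one-parameter group $\{\delta_r\}_{r>0}$ of smooth automorphisms (dilations) whose differentials at the identity $e$ are $\exp(A\log r)$, where $A$ is a diagonalizable endomorphism of the Lie algebra with positive eigenvalues. Let $\rho=\operatorname{tr}A$ be its homogeneous dimension, $\lambda$ a left Haar measure on $G$, and $|\cdot|$ a homogeneous norm on $G$: a continuous function $G\to[0,\infty)$ with $|x|=0\iff x=e$, $|x^{-1}|=|x|$ and $|\delta_r x|=r|x|$. Put $$\gamma=\inf\{c>0:\ |xy|\le c(|x|+|y|)\ \ \forall x,y\in G\},\qquad B_{(x,r)}=\{y\in G:\ |x^{-1}y|<r\}.$$ For $U,V\subset G$, a $U$-$V$ uniform partition of $G$ is a partition of $G$ into Borel sets such that every member $E$ contains a point $x_E$ with $x_EU\subset E\subset x_EV$. For each $r>0$ let $\pi_r$ be a $B$-$B^2$ uniform partition of $G$ with $B=B_{(e,\,r/(4\gamma^2))}$. Let $L_0(G)$ be the space of classes, modulo equality $\lambda$-a.e., of $\lambda$-measurable functions $G\to\mathbb C$. For $q,p,\alpha\in[1,\infty]$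 and $f\in L_0(G)$ put $$\|f\|_{q,p}^{\pi_r}=\Big(\sum_{E\in\pi_r}\|f\chi_E\|_q^p\Big)^{1/p}\ (p<\infty),\qquad \|f\|_{q,\infty}^{\pi_r}=\sup_{E\in\pi_r}\|f\chi_E\|_q,$$ $$\|f\|_{q,p,\alpha}=\sup_{r>0}\lambda(B_{(e,r)})^{\frac1\alpha-\frac1q}\,\|f\|_{q,p}^{\pi_r}\in[0,\infty]\quad(1/\infty=0),\qquad (L^q,L^p)^\alpha(G)=\{f\in L_0(G):\ \|f\|_{q,p,\alpha}<\infty\}.$$ Let $1\le q\le p\le\infty$. Then there is a finite constant $C=C(\gamma,\rho,p,q)$, depending only on $\gamma,\rho,p,q$, such that for every $f\in L_0(G)$ $$\|f\|_{q,p,p}\le\|f\|_p\le C\,\|f\|_{q,p,p}.$$ Consequently $(L^q,L^p)^p(G)=L^p(G)$. -/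

import Mathlib

open MeasureTheory Set
open scoped ENNReal NNReal Pointwise Manifold ContDiff

noncomputable section

/-- A family of dilations `δ_r` (`r > 0`) on a real Lie group `G` of dimension `n`: a continuous
one-parameter group of smooth automorphisms of `G` whose differentials at the identity are
`exp (log r • A)` for some diagonalizable endomorphism `A` of the Lie algebra with positive
eigenvalues. The endomorphism is given by an eigenbasis `basis` together with the list `weight`
of the corresponding eigenvalues, so that `A (basis i) = weight i • basis i`. -/
structure Dilations (n : ℕ) (G : Type*) [Group G] [TopologicalSpace G]
    [ChartedSpace (EuclideanSpace ℝ (Fin n)) G] where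
  dil : {r : ℝ // 0 < r} →* MulAut G
  contMDiff_dil : ∀ r, ContMDiff (𝓡 n) (𝓡 n) ∞ (dil r : G → G)
  continuous_dil : Continuous fun z : {r : ℝ // 0 < r} × G => dil z.1 z.2
  basis : Module.Basis (Fin n) ℝ (GroupLieAlgebra (𝓡 n) G)
  weight : Fin n → ℝ
  weight_pos : ∀ i, 0 < weight i
  mfderiv_dil : ∀ (r : {r : ℝ // 0 < r}) (i : Fin n),
    (mfderiv (𝓡 n) (𝓡 n) (dil r : G → G) 1 : GroupLieAlgebra (𝓡 n) G → GroupLieAlgebra (𝓡 n) G)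
      (basis i) = (r : ℝ) ^ weight i • basis i

section Homogeneous

variable {n : ℕ} {G : Type*} [Group G] [TopologicalSpace G]
  [ChartedSpace (EuclideanSpace ℝ (Fin n)) G]

/-- The homogeneous dimension: the trace of `A`, i.e. the sum of the weights. -/
def Dilations.homogeneousDim (D : Dilations n G) : ℝ := ∑ i, D.weight i

/-- A homogeneous norm on `G` with respect to the dilations `D`. -/
structure HomogeneousNorm (D : Dilations n G) where
  toFun : G → ℝ
  continuous_toFun : Continuous toFun
  nonneg : ∀ x, 0 ≤ toFun x
  eq_zero_iff : ∀ x, toFun x = 0 ↔ x = 1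
  inv : ∀ x, toFun x⁻¹ = toFun x
  dil : ∀ (r : {r : ℝ // 0 < r}) (x : G), toFun (D.dil r x) = r * toFun x

variable {D : Dilations n G}

/-- The best constant in the quasi-triangle inequality `|x y| ≤ c (|x| + |y|)`. -/
def HomogeneousNorm.gamma (N : HomogeneousNorm D) : ℝ :=
  sInf {c : ℝ | 0 < c ∧ ∀ x y : G, N.toFun (x * y) ≤ c * (N.toFun x + N.toFun y)}

/-- The ball `B_(x,r) = {y | |x⁻¹ y| < r}`. -/
def HomogeneousNorm.ball (N : HomogeneousNorm D) (x : G) (r : ℝ) : Set G :=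
  {y | N.toFun (x⁻¹ * y) < r}

end Homogeneous

/-- `π` is a `U`-`V` uniform partition of `G`: a partition of `G` into Borel sets `E`, each of
which contains a point `x` with `x U ⊆ E ⊆ x V`. (This notion is meant for relatively compact open
neighbourhoods `U`, `V` of the identity with `closure U ⊆ V`.) -/
def IsUniformPartition {G : Type*} [Group G] [MeasurableSpace G]
    (U V : Set G) (π : Set (Set G)) : Prop :=
  Setoid.IsPartition π ∧ (∀ E ∈ π, MeasurableSet E) ∧
    ∀ E ∈ π, ∃ x ∈ E, x • U ⊆ E ∧ E ⊆ x • V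

/-- `‖f‖_{q,p}^π`: the `ℓ^p(π)` norm of the family of the norms `‖f χ_E‖_q`, `E ∈ π`. -/
def partitionNorm {G : Type*} [MeasurableSpace G] (μ : Measure G) (π : Set (Set G))
    (q p : ℝ≥0∞) (f : G → ℂ) : ℝ≥0∞ :=
  if p = ⊤ then ⨆ E : π, eLpNorm ((E : Set G).indicator f) q μ
  else (∑' E : π, eLpNorm ((E : Set G).indicator f) q μ ^ p.toReal) ^ (1 / p.toReal)

section Amalgam

variable {n : ℕ} {G : Type*} [Group G] [TopologicalSpace G]
  [ChartedSpace (EuclideanSpace ℝ (Fin n)) G] [MeasurableSpace G] {D : Dilations n G}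

/-- `π r` is, for each `r > 0`, a `B`-`B²` uniform partition of `G`, with
`B = B_(e, r / (4 γ²))`. -/
def IsPartitionFamily (N : HomogeneousNorm D) (π : ℝ → Set (Set G)) : Prop :=
  ∀ r : ℝ, 0 < r →
    IsUniformPartition (N.ball 1 (r / (4 * N.gamma ^ 2)))
      (N.ball 1 (r / (4 * N.gamma ^ 2)) * N.ball 1 (r / (4 * N.gamma ^ 2))) (π r)

/-- `‖f‖_{q,p,α} = sup_{r > 0} λ(B_(e,r))^(1/α - 1/q) ‖f‖_{q,p}^{π_r}`, with `1/∞ = 0`. -/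
def fracNorm (N : HomogeneousNorm D) (μ : Measure G) (π : ℝ → Set (Set G))
    (q p α : ℝ≥0∞) (f : G →ₘ[μ] ℂ) : ℝ≥0∞ :=
  ⨆ (r : ℝ) (_ : 0 < r),
    μ (N.ball 1 r) ^ (α⁻¹.toReal - q⁻¹.toReal) * partitionNorm μ (π r) q p f

/-- The space `(L^q, L^p)^α(G)`. -/
def fracSpace (N : HomogeneousNorm D) (μ : Measure G) (π : ℝ → Set (Set G))
    (q p α : ℝ≥0∞) : Set (G →ₘ[μ] ℂ) :=
  {f | fracNorm N μ π q p α f < ⊤}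

end Amalgam

end

/-! Let q < ∞ and let m_r f(x) be the L^q mean of f over the cell of π_r containing x (`cellMean`).
Each cell E contains a translate of the ball of radius r/(4γ²) and lies in a ball of radius r, so
λ(E) ≤ λ(B_(e,r)) ≤ (4γ²)^ρ λ(E). The left inequality is Hölder on each cell: the factor λ(E)^(1/q -
1/p) is absorbed by the weight (`IsPartitionFamily.fracNorm_le`).

For the right inequality, the L^p norm of m_r f is the ℓ^p sum of λ(E)^(1/p - 1/q) ‖f χ_E‖_q, hence
at most C ‖f‖_{q,p,p} with C = (4γ²)^(ρ(1/q - 1/p)), uniformly in r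
(`IsPartitionFamily.eLpNorm_cellMean_le_fracNorm`). As r → 0 the cells shrink, and m_r f → |f| in
L^q when f ∈ L^q (`IsPartitionFamily.tendsto_cellMean`); Fatou along an a.e. convergent subsequence
transfers the bound to f. Truncation and a second use of Fatou remove the assumption f ∈ L^q.

The geometric input is λ(δ_r A) = r^ρ λ(A) for open A (`Dilations.measure_dil_image`). By uniqueness
of Haar measure δ_r multiplies λ by some c. In a chart at e, for small r, δ_r is a contraction close
to its differential, whose determinant is r^ρ. Under iteration on a small neighbourhood of e, Haar
measure changes by c^k and Lebesgue measure by about (r^ρ)^k. Near e the two are comparable up to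
fixed factors, so c = r^ρ. -/

open Filter Topology ProbabilityTheory

/-! ### Dilations and the group law in a chart at the identity -/

section Local

variable {n : ℕ} {G : Type*} [Group G] [TopologicalSpace G]
  [ChartedSpace (EuclideanSpace ℝ (Fin n)) G]

/-- The chart at the identity. -/
noncomputable abbrev unitChart (n : ℕ) (G : Type*) [Group G] [TopologicalSpace G]
    [ChartedSpace (EuclideanSpace ℝ (Fin n)) G] : PartialEquiv G (EuclideanSpace ℝ (Fin n)) :=
  extChartAt (𝓡 n) (1 : G)

/-- The coordinates of the identity. -/
noncomputable abbrev unitCoord (n : ℕ) (G : Type*) [Group G] [TopologicalSpace G]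
    [ChartedSpace (EuclideanSpace ℝ (Fin n)) G] : EuclideanSpace ℝ (Fin n) :=
  unitChart n G 1

/-- The differential of the dilation `δ_r` at the identity, read in the chart. -/
noncomputable def Dilations.differential (D : Dilations n G) (r : {r : ℝ // 0 < r}) :
    EuclideanSpace ℝ (Fin n) →L[ℝ] EuclideanSpace ℝ (Fin n) :=
  (mfderiv (𝓡 n) (𝓡 n) (D.dil r : G → G) 1 : _)

/-- The dilation `δ_r` read in the chart. -/
noncomputable def Dilations.chartDil (D : Dilations n G) (r : {r : ℝ // 0 < r}) :
    EuclideanSpace ℝ (Fin n) → EuclideanSpace ℝ (Fin n) :=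
  fun x => unitChart n G (D.dil r ((unitChart n G).symm x))

theorem unitChart_symm_unitCoord : (unitChart n G).symm (unitCoord n G) = 1 :=
  extChartAt_to_inv (I := 𝓡 n) (1 : G)

theorem continuousAt_unitChart : ContinuousAt (unitChart n G) 1 :=
  continuousAt_extChartAt (I := 𝓡 n) (1 : G)

theorem continuousAt_unitChart_symm : ContinuousAt (unitChart n G).symm (unitCoord n G) :=
  continuousAt_extChartAt_symm (I := 𝓡 n) (1 : G)

theorem contMDiffAt_unitChart_symm [IsManifold (𝓡 n) ∞ G] :
    ContMDiffAt 𝓘(ℝ, EuclideanSpace ℝ (Fin n)) (𝓡 n) ∞ (unitChart n G).symm (unitCoord n G) :=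
  (contMDiffOn_extChartAt_symm (I := 𝓡 n) (1 : G)).contMDiffAt
    (extChartAt_target_mem_nhds (I := 𝓡 n) (1 : G))

theorem contMDiffAt_unitChart [IsManifold (𝓡 n) ∞ G] :
    ContMDiffAt (𝓡 n) 𝓘(ℝ, EuclideanSpace ℝ (Fin n)) ∞ (unitChart n G) 1 :=
  contMDiffAt_extChartAt (I := 𝓡 n)

/-- The identity is fixed by δ_r, so `mfderiv` there is the ordinary derivative of the chart
expression. Smoothness makes it strict, which is what yields linear approximation on a whole
neighbourhood. -/
theorem Dilations.hasStrictFDerivAt_chartDil [IsManifold (𝓡 n) ∞ G] (D : Dilations n G)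
    (r : {r : ℝ // 0 < r}) :
    HasStrictFDerivAt (D.chartDil r) (D.differential r) (unitCoord n G) := by
  have h1 : ContDiffAt ℝ ∞ (D.chartDil r) (unitCoord n G) := by
    rw [← contMDiffAt_iff_contDiffAt]
    refine ContMDiffAt.comp (I' := 𝓡 n) (g := unitChart n G) (unitCoord n G) ?_
      (((D.contMDiff_dil r) _).comp _ contMDiffAt_unitChart_symm)
    rw [unitChart_symm_unitCoord, map_one]
    exact contMDiffAt_unitChart
  have h2 := h1.hasStrictFDerivAt (by simp)
  have h3 : fderiv ℝ (D.chartDil r) (unitCoord n G) = D.differential r := by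
    have hd : MDifferentiableAt (𝓡 n) (𝓡 n) (D.dil r : G → G) 1 :=
      ((D.contMDiff_dil r) 1).mdifferentiableAt (by simp)
    rw [Dilations.differential]
    have := hd.mfderiv
    rw [this]
    rw [modelWithCornersSelf_coe, range_id, fderivWithin_univ]
    congr 1
    funext x
    simp only [writtenInExtChartAt, map_one, Function.comp_apply, Dilations.chartDil]
  rwa [h3] at h2

/-- The group law read in the chart. -/
noncomputable def chartMul (n : ℕ) (G : Type*) [Group G] [TopologicalSpace G]
    [ChartedSpace (EuclideanSpace ℝ (Fin n)) G] (x y : EuclideanSpace ℝ (Fin n)) :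
    EuclideanSpace ℝ (Fin n) :=
  unitChart n G ((unitChart n G).symm x * (unitChart n G).symm y)

/-- Since e·y = y, the partial derivative in the second variable at the identity is the identity
map. Strict differentiability in both variables jointly makes one radius η serve every x. -/
theorem exists_ball_approximatesLinearOn_chartMul [LieGroup (𝓡 n) ∞ G] {ε : ℝ≥0} (hε : 0 < ε) :
    ∃ η > 0, ∀ x ∈ Metric.ball (unitCoord n G) η,
      ApproximatesLinearOn (chartMul n G x) (ContinuousLinearMap.id ℝ (EuclideanSpace ℝ (Fin n)))
        (Metric.ball (unitCoord n G) η) ε := by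
  have h1 : ContDiffAt ℝ ∞ (fun p : EuclideanSpace ℝ (Fin n) × EuclideanSpace ℝ (Fin n) =>
      chartMul n G p.1 p.2) (unitCoord n G, unitCoord n G) := by
    rw [← contMDiffAt_iff_contDiffAt]
    have hf : ContMDiffAt 𝓘(ℝ, EuclideanSpace ℝ (Fin n) × EuclideanSpace ℝ (Fin n)) (𝓡 n) ∞
        (fun p : EuclideanSpace ℝ (Fin n) × EuclideanSpace ℝ (Fin n) =>
          (unitChart n G).symm p.1) (unitCoord n G, unitCoord n G) :=
      ContMDiffAt.comp (unitCoord n G, unitCoord n G) (g := (unitChart n G).symm)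
        contMDiffAt_unitChart_symm contDiffAt_fst.contMDiffAt
    have hs : ContMDiffAt 𝓘(ℝ, EuclideanSpace ℝ (Fin n) × EuclideanSpace ℝ (Fin n)) (𝓡 n) ∞
        (fun p : EuclideanSpace ℝ (Fin n) × EuclideanSpace ℝ (Fin n) =>
          (unitChart n G).symm p.2) (unitCoord n G, unitCoord n G) :=
      ContMDiffAt.comp (unitCoord n G, unitCoord n G) (g := (unitChart n G).symm)
        contMDiffAt_unitChart_symm contDiffAt_snd.contMDiffAt
    refine ContMDiffAt.comp (I' := 𝓡 n) (g := unitChart n G) _ ?_ (hf.mul hs)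
    simp only [unitChart_symm_unitCoord, mul_one]
    exact contMDiffAt_unitChart
  have h2 := h1.hasStrictFDerivAt (by simp)
  set L := fderiv ℝ (fun p : EuclideanSpace ℝ (Fin n) × EuclideanSpace ℝ (Fin n) =>
      chartMul n G p.1 p.2) (unitCoord n G, unitCoord n G) with hL
  have h3 : L.comp (ContinuousLinearMap.inr ℝ _ _) = ContinuousLinearMap.id ℝ _ := by
    have ha : HasFDerivAt (fun y => chartMul n G (unitCoord n G) y)
        (L.comp (ContinuousLinearMap.inr ℝ _ _)) (unitCoord n G) :=
      h2.hasFDerivAt.comp (unitCoord n G) (hasFDerivAt_prodMk_right (unitCoord n G) (unitCoord n G))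
    refine ha.unique ((hasFDerivAt_id (unitCoord n G)).congr_of_eventuallyEq ?_)
    filter_upwards [extChartAt_target_mem_nhds (I := 𝓡 n) (1 : G)] with y hy
    rw [chartMul, unitChart_symm_unitCoord, one_mul]
    exact (unitChart n G).right_inv hy
  obtain ⟨s, hs, hs'⟩ := h2.approximates_deriv_on_nhds (c := ε) (Or.inr hε)
  obtain ⟨η, hη, hηs⟩ := Metric.mem_nhds_iff.1 hs
  refine ⟨η, hη, fun x hx y hy z hz => ?_⟩
  have key : ∀ y ∈ Metric.ball (unitCoord n G) η, (x, y) ∈ s := fun y hy => hηs (by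
    rw [← ball_prod_same]; exact ⟨hx, hy⟩)
  have := hs' (x, y) (key y hy) (x, z) (key z hz)
  have e : L ((x, y) - (x, z)) = y - z := by
    have := congrArg (fun f => f (y - z)) h3
    simpa using this
  rw [e] at this
  have e2 : ‖(x, y) - (x, z)‖ = ‖y - z‖ := by simp [Prod.norm_def]
  rw [e2] at this
  simpa using this

theorem Dilations.differential_basis (D : Dilations n G) (r : {r : ℝ // 0 < r}) (i : Fin n) :
    D.differential r (D.basis i) = (r : ℝ) ^ D.weight i • D.basis i :=
  D.mfderiv_dil r i

/-- The eigenbasis of the dilations as a basis of the model space. -/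
noncomputable def Dilations.coordBasis (D : Dilations n G) :
    Module.Basis (Fin n) ℝ (EuclideanSpace ℝ (Fin n)) := D.basis

/-- The differential is diagonal in the eigenbasis; this is where ρ = tr A enters. -/
theorem Dilations.det_differential (D : Dilations n G) (r : {r : ℝ // 0 < r}) :
    (D.differential r).det = (r : ℝ) ^ D.homogeneousDim := by
  have : LinearMap.toMatrix D.coordBasis D.coordBasis (D.differential r).toLinearMap =
      Matrix.diagonal (fun i => (r : ℝ) ^ D.weight i) := by
    ext i j
    have h : D.differential r (D.coordBasis j) = (r : ℝ) ^ D.weight j • D.coordBasis j :=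
      D.differential_basis r j
    rw [LinearMap.toMatrix_apply, ContinuousLinearMap.coe_coe, h, map_smul,
      Module.Basis.repr_self, Matrix.diagonal_apply]
    by_cases hij : i = j
    · subst hij; simp
    · simp [hij]
  rw [ContinuousLinearMap.det, ← LinearMap.det_toMatrix D.coordBasis, this, Matrix.det_diagonal,
    Dilations.homogeneousDim, Real.rpow_sum_of_pos r.2]

theorem Dilations.exists_norm_differential_le (D : Dilations n G) {ε : ℝ} (hε : 0 < ε) :
    ∃ r₀ > 0, ∀ r : {r : ℝ // 0 < r}, r.1 < r₀ → ‖D.differential r‖ ≤ ε := by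
  -- The rank-one projections onto the eigenlines: the differential is Σ r^(weight i) P i, which
  -- tends to 0 with r because the weights are positive.
  let P : Fin n → (EuclideanSpace ℝ (Fin n) →L[ℝ] EuclideanSpace ℝ (Fin n)) := fun i =>
    (LinearMap.toContinuousLinearMap (D.coordBasis.coord i)).smulRight (D.coordBasis i)
  have hP : ∀ r : {r : ℝ // 0 < r}, D.differential r = ∑ i, (r : ℝ) ^ D.weight i • P i := by
    intro r
    apply ContinuousLinearMap.coe_injective
    apply D.coordBasis.ext
    intro i
    have h : D.differential r (D.coordBasis i) = (r : ℝ) ^ D.weight i • D.coordBasis i :=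
      D.differential_basis r i
    rw [ContinuousLinearMap.coe_coe, h, ContinuousLinearMap.coe_coe,
      _root_.sum_apply, Finset.sum_eq_single i]
    · simp [P]
    · intro j _ hj
      simp [P, hj.symm]
    · simp
  have ht : Tendsto (fun r : ℝ => ‖∑ i, r ^ D.weight i • P i‖) (𝓝 0) (𝓝 0) := by
    have : Tendsto (fun r : ℝ => ∑ i, r ^ D.weight i • P i) (𝓝 0)
        (𝓝 (∑ i, (0 : ℝ) ^ D.weight i • P i)) := by
      refine tendsto_finsetSum _ fun i _ => Tendsto.smul_const ?_ _
      exact (Real.continuousAt_rpow_const _ _ (Or.inr (D.weight_pos i).le)).tendsto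
    have h0 : ∑ i, (0 : ℝ) ^ D.weight i • P i = 0 :=
      Finset.sum_eq_zero fun i _ => by
      rw [Real.zero_rpow (D.weight_pos i).ne']; exact zero_smul ℝ (P i)
    rw [h0] at this
    simpa using this.norm
  obtain ⟨r₀, hr₀, h⟩ := Metric.eventually_nhds_iff.1 (ht.eventually_le_const hε)
  refine ⟨r₀, hr₀, fun r hr => ?_⟩
  rw [hP]
  apply h
  rw [Real.dist_eq, sub_zero, abs_of_pos r.2]
  exact hr

theorem Dilations.chartDil_unitCoord (D : Dilations n G) (r : {r : ℝ // 0 < r}) :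
    D.chartDil r (unitCoord n G) = unitCoord n G := by
  rw [chartDil, unitChart_symm_unitCoord, map_one]

/-- For small `r`, the dilation `δ_r` read in the chart is a contraction near the identity, and
it is as close to its differential as we like. -/
theorem Dilations.exists_ball_contraction [IsManifold (𝓡 n) ∞ G] (D : Dilations n G)
    {r : {r : ℝ // 0 < r}} (hr : ‖D.differential r‖ ≤ 1 / 4) {ε : ℝ≥0} (hε : 0 < ε) :
    ∃ η₀ > 0, ∀ η : ℝ, 0 < η → η ≤ η₀ →
      Metric.ball (unitCoord n G) η ⊆ (unitChart n G).target ∧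
      ApproximatesLinearOn (D.chartDil r) (D.differential r) (Metric.ball (unitCoord n G) η) ε ∧
      (∀ x ∈ Metric.ball (unitCoord n G) η,
        dist (D.chartDil r x) (unitCoord n G) ≤ 1 / 2 * dist x (unitCoord n G)) ∧
      ∀ x ∈ Metric.ball (unitCoord n G) η,
        (unitChart n G).symm (D.chartDil r x) = D.dil r ((unitChart n G).symm x) := by
  -- The cap 1/4 on the error, added to the bound 1/4 on the differential, gives the contraction
  -- factor 1/2.
  have hε' : 0 < min ε (1 / 4) := lt_min hε (by positivity)
  obtain ⟨s, hs, hs'⟩ := (D.hasStrictFDerivAt_chartDil r).approximates_deriv_on_nhds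
    (c := min ε (1 / 4)) (Or.inr hε')
  have hsrc : ∀ᶠ x in 𝓝 (unitCoord n G),
      D.dil r ((unitChart n G).symm x) ∈ (unitChart n G).source := by
    have hc : ContinuousAt (fun x => D.dil r ((unitChart n G).symm x)) (unitCoord n G) :=
      (D.contMDiff_dil r).continuous.continuousAt.comp continuousAt_unitChart_symm
    apply hc.eventually_mem
    rw [unitChart_symm_unitCoord, map_one]
    exact extChartAt_source_mem_nhds (I := 𝓡 n) (1 : G)
  obtain ⟨η₀, hη₀, hsub⟩ := Metric.mem_nhds_iff.1
    (inter_mem (inter_mem hs (extChartAt_target_mem_nhds (I := 𝓡 n) (1 : G))) hsrc)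
  refine ⟨η₀, hη₀, fun η hη hηle => ?_⟩
  have hb : Metric.ball (unitCoord n G) η ⊆ Metric.ball (unitCoord n G) η₀ :=
    Metric.ball_subset_ball hηle
  refine ⟨fun x hx => (hsub (hb hx)).1.2, ?_, ?_, ?_⟩
  · exact (hs'.mono_set fun x hx => (hsub (hb hx)).1.1).mono_num (min_le_left _ _)
  · intro x hx
    have h1 := hs' x (hsub (hb hx)).1.1 _ (mem_of_mem_nhds hs)
    rw [D.chartDil_unitCoord] at h1
    rw [dist_eq_norm, dist_eq_norm]
    have h2 := (D.differential r).le_of_opNorm_le hr (x - unitCoord n G)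
    have h3 : ((min ε (1 / 4) : ℝ≥0) : ℝ) ≤ 1 / 4 := by
      have : ((min ε (1 / 4) : ℝ≥0)) ≤ 1 / 4 := min_le_right _ _
      exact_mod_cast this
    have h4 : ‖D.chartDil r x - unitCoord n G‖ ≤
        ‖D.chartDil r x - unitCoord n G - D.differential r (x - unitCoord n G)‖ +
          ‖D.differential r (x - unitCoord n G)‖ := by
      simpa using norm_add_le (D.chartDil r x - unitCoord n G - D.differential r (x - unitCoord n G))
        (D.differential r (x - unitCoord n G))
    nlinarith [norm_nonneg (x - unitCoord n G)]
  · intro x hx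
    exact (unitChart n G).left_inv (hsub (hb hx)).2

end Local

/-! ### Relative compactness of homogeneous balls -/

section Balls

variable {n : ℕ} {G : Type*} [Group G] [TopologicalSpace G]
  [ChartedSpace (EuclideanSpace ℝ (Fin n)) G]

/-- A contraction keeps orbits inside the ball, so the chart expression of δ_r can be iterated and
still represents the powers of δ_r. -/
theorem Dilations.iterate_chartDil (D : Dilations n G) {r : {r : ℝ // 0 < r}} {η : ℝ}
    (h1 : ∀ x ∈ Metric.ball (unitCoord n G) η,
      dist (D.chartDil r x) (unitCoord n G) ≤ 1 / 2 * dist x (unitCoord n G))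
    (h2 : ∀ x ∈ Metric.ball (unitCoord n G) η,
      (unitChart n G).symm (D.chartDil r x) = D.dil r ((unitChart n G).symm x))
    {x : EuclideanSpace ℝ (Fin n)} (hx : x ∈ Metric.ball (unitCoord n G) η) (k : ℕ) :
    (D.chartDil r)^[k] x ∈ Metric.ball (unitCoord n G) η ∧
      dist ((D.chartDil r)^[k] x) (unitCoord n G) ≤ (1 / 2) ^ k * dist x (unitCoord n G) ∧
      (unitChart n G).symm ((D.chartDil r)^[k] x) = D.dil (r ^ k) ((unitChart n G).symm x) := by
  induction k with
  | zero => simpa using hx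
  | succ k ih =>
    obtain ⟨i1, i2, i3⟩ := ih
    have h := h1 _ i1
    rw [Function.iterate_succ_apply']
    refine ⟨?_, ?_, ?_⟩
    · rw [Metric.mem_ball] at i1 ⊢
      linarith [dist_nonneg (x := (D.chartDil r)^[k] x) (y := unitCoord n G)]
    · rw [pow_succ]
      linarith
    · rw [h2 _ i1, i3, pow_succ', map_mul, MulAut.mul_apply]

theorem Dilations.continuous_dil_apply (D : Dilations n G) (r : {r : ℝ // 0 < r}) :
    Continuous (D.dil r : G → G) :=
  (D.contMDiff_dil r).continuous

/-- The iterates of a strong contraction `δ_r` shrink every point to the identity. -/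
theorem Dilations.tendsto_dil_pow [LieGroup (𝓡 n) ∞ G] [ConnectedSpace G] (D : Dilations n G)
    {r : {r : ℝ // 0 < r}} (hr : ‖D.differential r‖ ≤ 1 / 4) (x : G) :
    Tendsto (fun k : ℕ => D.dil (r ^ k) x) atTop (𝓝 1) := by
  have : IsTopologicalGroup G := topologicalGroup_of_lieGroup (𝓡 n) ∞
  -- The attracted points form a subgroup. It contains a neighbourhood of the identity, hence is
  -- open and closed, hence is everything by connectedness.
  let H : Subgroup G :=
    { carrier := {x | Tendsto (fun k : ℕ => D.dil (r ^ k) x) atTop (𝓝 1)}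
      mul_mem' := fun {a b} ha hb => by
        simpa using Tendsto.mul (M := G) ha hb
      one_mem' := by simpa using tendsto_const_nhds
      inv_mem' := fun {a} ha => by
        simpa using Tendsto.inv (G := G) ha }
  have hH : (H : Set G) ∈ 𝓝 (1 : G) := by
    obtain ⟨η, hη, hη'⟩ := D.exists_ball_contraction hr one_pos
    obtain ⟨_, -, h1, h2⟩ := hη' η hη le_rfl
    have hs : (unitChart n G) ⁻¹' Metric.ball (unitCoord n G) η ∈ 𝓝 (1 : G) :=
      continuousAt_unitChart.preimage_mem_nhds (Metric.ball_mem_nhds _ hη)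
    filter_upwards [hs, extChartAt_source_mem_nhds (I := 𝓡 n) (1 : G)] with y hy hy'
    have hit := fun k => D.iterate_chartDil h1 h2 hy k
    change Tendsto (fun k : ℕ => D.dil (r ^ k) y) atTop (𝓝 1)
    have hl : Tendsto (fun k => (D.chartDil r)^[k] (unitChart n G y)) atTop
        (𝓝 (unitCoord n G)) := by
      rw [tendsto_iff_dist_tendsto_zero]
      refine squeeze_zero (fun _ => dist_nonneg) (fun k => (hit k).2.1) ?_
      simpa using (tendsto_pow_atTop_nhds_zero_of_lt_one (by norm_num : (0 : ℝ) ≤ 1 / 2)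
        (by norm_num)).mul_const (dist (unitChart n G y) (unitCoord n G))
    have h3 := (continuousAt_unitChart_symm (n := n) (G := G)).tendsto.comp hl
    rw [unitChart_symm_unitCoord] at h3
    refine h3.congr fun k => ?_
    rw [Function.comp_apply, (hit k).2.2, (unitChart n G).left_inv hy']
  have ho : IsOpen (H : Set G) := H.isOpen_of_mem_nhds hH
  have hu : (H : Set G) = univ :=
    IsClopen.eq_univ ⟨H.isClosed_of_isOpen ho, ho⟩ ⟨1, H.one_mem⟩
  exact (hu ▸ mem_univ x : x ∈ (H : Set G))

variable {D : Dilations n G}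

/-- Small homogeneous balls lie in a given compact neighbourhood of the identity. -/
theorem HomogeneousNorm.exists_lt_imp_mem [LieGroup (𝓡 n) ∞ G] [ConnectedSpace G] [T2Space G]
    (N : HomogeneousNorm D) {K : Set G} (hK : IsCompact K) (hK1 : K ∈ 𝓝 (1 : G)) :
    ∃ m > 0, ∀ x, N.toFun x < m → x ∈ K := by
  obtain ⟨r₀, hr₀, hd⟩ := D.exists_norm_differential_le (ε := 1 / 4) (by norm_num)
  let r : {r : ℝ // 0 < r} := ⟨min (r₀ / 2) (1 / 2), by positivity⟩
  have hr : ‖D.differential r‖ ≤ 1 / 4 :=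
    hd r ((min_le_left _ _).trans_lt (half_lt_self hr₀))
  have hr1 : r.1 ≤ 1 := (min_le_right _ _).trans (by norm_num)
  have hF : IsCompact (frontier (interior K)) :=
    hK.of_isClosed_subset isClosed_frontier
      (frontier_subset_closure.trans (closure_minimal interior_subset hK.isClosed))
  have h1K : (1 : G) ∈ interior K := mem_interior_iff_mem_nhds.2 hK1
  have hpos : ∀ x ∈ frontier (interior K), 0 < N.toFun x := by
    intro x hx
    refine (N.nonneg x).lt_of_ne fun h => ?_
    rw [isOpen_interior.frontier_eq] at hx
    exact hx.2 (((N.eq_zero_iff x).1 h.symm) ▸ h1K)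
  -- The path s ↦ δ_(exp s) x, s ≤ 0, starts at x outside K and enters the interior of K, so it
  -- crosses the frontier; the norm along it never exceeds |x|. The minimum of the norm on the
  -- compact frontier is therefore the required m.
  have hmeet : ∀ x, x ∉ K → ∃ y ∈ frontier (interior K), N.toFun y ≤ N.toFun x := by
    intro x hx
    obtain ⟨k, hk⟩ := ((D.tendsto_dil_pow hr x).eventually_mem
      (isOpen_interior.mem_nhds h1K)).exists
    let c : ℝ → G := fun s => D.dil ⟨Real.exp s, Real.exp_pos s⟩ x
    have hc : Continuous c :=
      D.continuous_dil.comp ((Real.continuous_exp.subtype_mk _).prodMk continuous_const)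
    have hpre : IsPreconnected (c '' Iic 0) := isPreconnected_Iic.image c hc.continuousOn
    have hrk : (r ^ k : {r : ℝ // 0 < r}) = ⟨Real.exp (Real.log ((r : ℝ) ^ k)),
        Real.exp_pos _⟩ := by
      apply Subtype.ext
      exact (Real.exp_log (pow_pos r.2 k)).symm
    have hin : (c '' Iic 0 ∩ interior K).Nonempty := by
      refine ⟨_, ⟨Real.log ((r : ℝ) ^ k), ?_, rfl⟩, ?_⟩
      · exact Real.log_nonpos (pow_pos r.2 k).le (pow_le_one₀ r.2.le hr1)
      · simp only [c]
        rw [← hrk]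
        exact hk
    have hout : (c '' Iic 0 \ interior K).Nonempty := by
      refine ⟨_, ⟨0, mem_Iic.2 le_rfl, rfl⟩, fun h => hx (interior_subset ?_)⟩
      have : (⟨Real.exp 0, Real.exp_pos 0⟩ : {r : ℝ // 0 < r}) = 1 := Subtype.ext Real.exp_zero
      simpa only [c, this, map_one, MulAut.one_apply] using h
    obtain ⟨y, ⟨s, hs, rfl⟩, hy⟩ : (c '' Iic 0 ∩ frontier (interior K)).Nonempty := by
      by_contra hne
      rw [not_nonempty_iff_eq_empty, ← disjoint_iff_inter_eq_empty, disjoint_left] at hne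
      have hcl : ∀ y ∈ c '' Iic 0, y ∈ closure (interior K) → y ∈ interior K := by
        intro y hy hy'
        by_contra hyi
        exact hne hy (by rw [isOpen_interior.frontier_eq]; exact ⟨hy', hyi⟩)
      obtain ⟨y, hy, hyi, hyc⟩ := hpre (interior K) (closure (interior K))ᶜ isOpen_interior
        isClosed_closure.isOpen_compl
        (fun y hy => or_iff_not_imp_right.2 fun h => hcl y hy (not_not.1 h)) hin
        (hout.mono fun y hy => ⟨hy.1, fun h => hy.2 (hcl y hy.1 h)⟩)
      exact hyc (subset_closure hyi)
    refine ⟨_, hy, ?_⟩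
    rw [N.dil]
    exact mul_le_of_le_one_left (N.nonneg x) (Real.exp_le_one_iff.2 hs)
  rcases (frontier (interior K)).eq_empty_or_nonempty with he | hne
  · refine ⟨1, one_pos, fun x _ => by_contra fun hx => ?_⟩
    obtain ⟨y, hy, -⟩ := hmeet x hx
    rw [he] at hy
    exact hy
  · obtain ⟨z, hz, hmin⟩ := hF.exists_isMinOn hne N.continuous_toFun.continuousOn
    refine ⟨N.toFun z, hpos z hz, fun x hxm => by_contra fun hx => ?_⟩
    obtain ⟨y, hy, hyx⟩ := hmeet x hx
    exact absurd ((hmin hy).trans hyx) (not_le.2 hxm)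

theorem HomogeneousNorm.mem_ball_one (N : HomogeneousNorm D) {x : G} {r : ℝ} :
    x ∈ N.ball 1 r ↔ N.toFun x < r := by
  simp [HomogeneousNorm.ball]

/-- Homogeneous balls are relatively compact. -/
theorem HomogeneousNorm.exists_isCompact_ball_subset [LieGroup (𝓡 n) ∞ G] [ConnectedSpace G]
    [T2Space G] (N : HomogeneousNorm D) (R : ℝ) : ∃ K, IsCompact K ∧ N.ball 1 R ⊆ K := by
  have := ChartedSpace.locallyCompactSpace (EuclideanSpace ℝ (Fin n)) G
  obtain ⟨K, hK, hK1⟩ := exists_compact_mem_nhds (1 : G)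
  obtain ⟨m, hm, h⟩ := N.exists_lt_imp_mem hK hK1
  -- The denominator |R| + 1 is positive and exceeds R for every real R, so t shrinks the ball into
  -- the region where the norm is below m.
  let t : {r : ℝ // 0 < r} := ⟨m / (|R| + 1), by positivity⟩
  refine ⟨D.dil t⁻¹ '' K, hK.image (D.continuous_dil_apply _), fun x hx => ?_⟩
  refine ⟨D.dil t x, h _ ?_, by rw [← MulAut.mul_apply, ← map_mul]; simp⟩
  rw [N.dil]
  have hx' := N.mem_ball_one.1 hx
  have h1 : N.toFun x < |R| + 1 := by linarith [le_abs_self R]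
  calc m / (|R| + 1) * N.toFun x < m / (|R| + 1) * (|R| + 1) := by gcongr
    _ = m := by field_simp

/-- Balls of integer radius exhaust G and are relatively compact, so G is σ-compact. Second
countability is what makes Tonelli on G × ℝⁿ available. -/
theorem HomogeneousNorm.secondCountableTopology [LieGroup (𝓡 n) ∞ G] [ConnectedSpace G]
    [T2Space G] (N : HomogeneousNorm D) : SecondCountableTopology G := by
  have : SigmaCompactSpace G := by
    choose K hK hb using fun k : ℕ => N.exists_isCompact_ball_subset (k : ℝ)
    refine ⟨⟨K, hK, eq_univ_of_forall fun x => ?_⟩⟩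
    obtain ⟨k, hk⟩ := exists_nat_gt (N.toFun x)
    exact mem_iUnion.2 ⟨k, hb k (N.mem_ball_one.2 hk)⟩
  exact ChartedSpace.secondCountable_of_sigmaCompact (EuclideanSpace ℝ (Fin n)) G

end Balls

/-- Fixed factors do not affect exponential growth rates: if c < m, dividing by m^k would force A =
0. -/
theorem ENNReal.le_of_forall_mul_pow_le {A B : ℝ≥0∞} (hA : A ≠ 0) (hB : B ≠ ⊤) {m c : ℝ≥0}
    (h : ∀ k : ℕ, A * (m : ℝ≥0∞) ^ k ≤ B * (c : ℝ≥0∞) ^ k) : m ≤ c := by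
  by_contra! hlt
  have hm : m ≠ 0 := (zero_le.trans_lt hlt).ne'
  have hm' : (m : ℝ≥0∞) ≠ 0 := by simpa using hm
  have h1 : ∀ k : ℕ, A ≤ B * ((c / m : ℝ≥0) : ℝ≥0∞) ^ k := by
    intro k
    have hk : (m : ℝ≥0∞) ^ k ≠ 0 := pow_ne_zero _ hm'
    have hk' : (m : ℝ≥0∞) ^ k ≠ ⊤ := ENNReal.pow_ne_top ENNReal.coe_ne_top
    refine (ENNReal.mul_le_mul_iff_left hk hk').1 ((h k).trans_eq ?_)
    rw [mul_assoc, ← mul_pow, ← ENNReal.coe_mul, div_mul_cancel₀ _ hm]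
  have h2 : Tendsto (fun k : ℕ => B * ((c / m : ℝ≥0) : ℝ≥0∞) ^ k) atTop (𝓝 (B * 0)) := by
    refine ENNReal.Tendsto.const_mul (ENNReal.tendsto_pow_atTop_nhds_zero_of_lt_one ?_)
      (Or.inr hB)
    rw [ENNReal.coe_lt_one_iff]
    exact (div_lt_one (pos_iff_ne_zero.2 hm)).2 hlt
  rw [mul_zero] at h2
  exact hA (le_antisymm (ge_of_tendsto' h2 h1) zero_le)

/-! ### Haar measure against Lebesgue measure near the identity -/

section Comparison

variable {n : ℕ} {G : Type*} [Group G] [TopologicalSpace G]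
  [ChartedSpace (EuclideanSpace ℝ (Fin n)) G]

/-- Pairs `(g, y)` with `g ∈ W`, `y` in the ball of radius `η`, such that `y` lies in the left
translate by `g` of `S`, all in coordinates. -/
def translatePairs (W : Set G) (η : ℝ) (S : Set (EuclideanSpace ℝ (Fin n))) :
    Set (G × EuclideanSpace ℝ (Fin n)) :=
  {z | (z.1 ∈ W ∧ z.2 ∈ Metric.ball (unitCoord n G) η) ∧
    z.1⁻¹ * (unitChart n G).symm z.2 ∈ (unitChart n G).symm '' S}

/-- Provides the measurability needed to compute the product measure of this set in both orders. -/
theorem isOpen_translatePairs [IsTopologicalGroup G] {W : Set G} (hW : IsOpen W) {η : ℝ}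
    (hη : Metric.ball (unitCoord n G) η ⊆ (unitChart n G).target)
    {S : Set (EuclideanSpace ℝ (Fin n))} (hS : IsOpen ((unitChart n G).symm '' S)) :
    IsOpen (translatePairs W η S) := by
  have hc : ContinuousOn (fun z : G × EuclideanSpace ℝ (Fin n) =>
      z.1⁻¹ * (unitChart n G).symm z.2) (W ×ˢ Metric.ball (unitCoord n G) η) := by
    refine continuous_fst.inv.continuousOn.mul ?_
    exact (continuousOn_extChartAt_symm (I := 𝓡 n) (1 : G)).comp continuous_snd.continuousOn
      fun z hz => hη hz.2
  exact hc.isOpen_inter_preimage (hW.prod Metric.isOpen_ball) hS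

theorem unitChart_mul_eq_chartMul {g : G} (hg : g ∈ (unitChart n G).source)
    (s : EuclideanSpace ℝ (Fin n)) :
    unitChart n G (g * (unitChart n G).symm s) = chartMul n G (unitChart n G g) s := by
  rw [chartMul, (unitChart n G).left_inv hg]

variable [MeasurableSpace G] [BorelSpace G] (μ : Measure G)

/-- Near the identity, Haar measure (composed with inversion) is dominated by Lebesgue measure in
the chart. -/
theorem exists_haar_inv_le_volume [μ.IsHaarMeasure] [LieGroup (𝓡 n) ∞ G]
    [SecondCountableTopology G] :
    ∃ η > 0, ∃ c C : ℝ≥0∞, c ≠ 0 ∧ C ≠ ⊤ ∧ ∀ S ⊆ Metric.ball (unitCoord n G) η,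
      IsOpen ((unitChart n G).symm '' S) →
        c * μ ((unitChart n G).symm '' S)⁻¹ ≤ C * volume S := by
  have : IsTopologicalGroup G := topologicalGroup_of_lieGroup (𝓡 n) ∞
  have : LocallyCompactSpace G := ChartedSpace.locallyCompactSpace (EuclideanSpace ℝ (Fin n)) G
  -- Left translations by elements near the identity have derivative near the identity map, so they
  -- at most double Lebesgue measure.
  obtain ⟨ε, hε, hεpos⟩ := ((addHaar_image_le_mul_of_det_lt volume
    (ContinuousLinearMap.id ℝ (EuclideanSpace ℝ (Fin n))) (m := 2)
    (by simp [ContinuousLinearMap.det])).and self_mem_nhdsWithin).exists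
  obtain ⟨η₁, hη₁, happ⟩ := exists_ball_approximatesLinearOn_chartMul (n := n) (G := G) hεpos
  obtain ⟨K, hK, hK1⟩ := exists_compact_mem_nhds (1 : G)
  have hWn : K ∩ ((unitChart n G) ⁻¹' Metric.ball (unitCoord n G) η₁ ∩
      (unitChart n G).source) ∈ 𝓝 (1 : G) :=
    inter_mem hK1 (inter_mem
      (continuousAt_unitChart.preimage_mem_nhds (Metric.ball_mem_nhds _ hη₁))
      (extChartAt_source_mem_nhds (I := 𝓡 n) (1 : G)))
  obtain ⟨W, hW, hWo, hW1⟩ := mem_nhds_iff.1 hWn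
  have hcont : ContinuousAt (fun p : EuclideanSpace ℝ (Fin n) × EuclideanSpace ℝ (Fin n) =>
      (unitChart n G).symm p.1 * ((unitChart n G).symm p.2)⁻¹)
      (unitCoord n G, unitCoord n G) :=
    (ContinuousAt.comp (f := Prod.fst) (g := (unitChart n G).symm)
      continuousAt_unitChart_symm continuousAt_fst).mul
      (ContinuousAt.comp (f := Prod.snd) (g := (unitChart n G).symm)
        continuousAt_unitChart_symm continuousAt_snd).inv
  have hWm : (fun p : EuclideanSpace ℝ (Fin n) × EuclideanSpace ℝ (Fin n) =>
      (unitChart n G).symm p.1 * ((unitChart n G).symm p.2)⁻¹) ⁻¹' W ∈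
      𝓝 (unitCoord n G, unitCoord n G) := by
    refine hcont.preimage_mem_nhds ?_
    rw [unitChart_symm_unitCoord, inv_one, mul_one]
    exact hWo.mem_nhds hW1
  -- For y and s within η₂ of the origin of the chart, y s⁻¹ stays in W, so the slice over y
  -- contains all of y S⁻¹.
  obtain ⟨η₂, hη₂, hη₂W⟩ := Metric.mem_nhds_iff.1 hWm
  obtain ⟨η₃, hη₃, hη₃t⟩ := Metric.mem_nhds_iff.1
    (extChartAt_target_mem_nhds (I := 𝓡 n) (1 : G))
  set η := min η₁ (min η₂ η₃) with hηdef
  have hη : 0 < η := lt_min hη₁ (lt_min hη₂ hη₃)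
  have ht : Metric.ball (unitCoord n G) η ⊆ (unitChart n G).target :=
    (Metric.ball_subset_ball ((min_le_right _ _).trans (min_le_right _ _))).trans hη₃t
  refine ⟨η, hη, volume (Metric.ball (unitCoord n G) η), 2 * μ W,
    (Metric.measure_ball_pos _ _ hη).ne', ENNReal.mul_ne_top (by simp) ?_, fun S hS hSo => ?_⟩
  · exact ((measure_mono fun x hx => (hW hx).1).trans_lt hK.measure_lt_top).ne
  have hZ : MeasurableSet (translatePairs W η S) := (isOpen_translatePairs hWo ht hSo).measurableSet
  -- Tonelli on the set of pairs (g, y) with g⁻¹y ∈ S. For fixed y the relevant set is y S⁻¹, of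
  -- measure μ(S⁻¹) by left invariance, which is why the inverse appears; for fixed g it is a
  -- translate gS, of volume at most 2 vol S.
  calc volume (Metric.ball (unitCoord n G) η) * μ ((unitChart n G).symm '' S)⁻¹
      = ∫⁻ y in Metric.ball (unitCoord n G) η, μ ((unitChart n G).symm '' S)⁻¹ := by
        rw [setLIntegral_const, mul_comm]
    _ ≤ ∫⁻ y in Metric.ball (unitCoord n G) η, μ ((fun g => (g, y)) ⁻¹' translatePairs W η S) := by
        refine setLIntegral_mono' measurableSet_ball fun y hy => ?_
        rw [← measure_smul μ ((unitChart n G).symm y) ((unitChart n G).symm '' S)⁻¹]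
        refine measure_mono ?_
        rintro _ ⟨z, ⟨s, hs, hsz⟩, rfl⟩
        have hz : z = ((unitChart n G).symm s)⁻¹ := by rw [hsz, inv_inv]
        subst hz
        have hys : (y, s) ∈ Metric.ball (unitCoord n G, unitCoord n G) η₂ := by
          rw [← ball_prod_same]
          have hle : η ≤ η₂ := (min_le_right _ _).trans (min_le_left _ _)
          exact ⟨Metric.ball_subset_ball hle hy, Metric.ball_subset_ball hle (hS hs)⟩
        exact ⟨⟨hη₂W hys, hy⟩, s, hs, by simp⟩
    _ ≤ ∫⁻ y, μ ((fun g => (g, y)) ⁻¹' translatePairs W η S) := setLIntegral_le_lintegral _ _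
    _ = ∫⁻ g, volume (Prod.mk g ⁻¹' translatePairs W η S) ∂μ := by
        rw [← Measure.prod_apply hZ, Measure.prod_apply_symm hZ]
    _ ≤ ∫⁻ g, W.indicator (fun _ => 2 * volume S) g ∂μ := by
        refine lintegral_mono fun g => ?_
        by_cases hg : g ∈ W
        · rw [indicator_of_mem hg]
          have hgW := (hW hg).2
          refine (measure_mono (t := chartMul n G (unitChart n G g) '' S) ?_).trans
            (hε S _ ((happ _ hgW.1).mono_set
              (hS.trans (Metric.ball_subset_ball (min_le_left _ _)))))
          rintro y ⟨⟨-, hy⟩, s, hs, hsy⟩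
          refine ⟨s, hs, ?_⟩
          rw [← unitChart_mul_eq_chartMul hgW.2, hsy, mul_inv_cancel_left]
          exact (unitChart n G).right_inv (ht hy)
        · rw [indicator_of_notMem hg]
          refine (measure_mono_null (t := ∅) ?_ measure_empty).le
          exact fun y hy => hg hy.1.1
    _ = 2 * μ W * volume S := by
        rw [lintegral_indicator_const hWo.measurableSet]
        ring

/-- Near the identity, Haar measure (composed with inversion) dominates Lebesgue measure in
the chart. -/
theorem exists_volume_le_haar_inv [μ.IsHaarMeasure] [LieGroup (𝓡 n) ∞ G]
    [SecondCountableTopology G] :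
    ∃ η > 0, ∃ c C : ℝ≥0∞, c ≠ 0 ∧ C ≠ ⊤ ∧ ∀ S ⊆ Metric.ball (unitCoord n G) η,
      IsOpen ((unitChart n G).symm '' S) →
        c * volume S ≤ C * μ ((unitChart n G).symm '' S)⁻¹ := by
  have : IsTopologicalGroup G := topologicalGroup_of_lieGroup (𝓡 n) ∞
  have : LocallyCompactSpace G := ChartedSpace.locallyCompactSpace (EuclideanSpace ℝ (Fin n)) G
  obtain ⟨ε, hε, hεpos⟩ := ((mul_le_addHaar_image_of_lt_det volume
    (ContinuousLinearMap.id ℝ (EuclideanSpace ℝ (Fin n))) (m := 1 / 2)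
    (by simp [ContinuousLinearMap.det])).and self_mem_nhdsWithin).exists
  obtain ⟨η₁, hη₁, happ⟩ := exists_ball_approximatesLinearOn_chartMul (n := n) (G := G) hεpos
  obtain ⟨η₃, hη₃, hη₃t⟩ := Metric.mem_nhds_iff.1
    (extChartAt_target_mem_nhds (I := 𝓡 n) (1 : G))
  have hWn : (unitChart n G) ⁻¹' Metric.ball (unitCoord n G) η₁ ∩
      (unitChart n G).source ∈ 𝓝 (1 : G) :=
    inter_mem
      (continuousAt_unitChart.preimage_mem_nhds (Metric.ball_mem_nhds _ hη₁))
      (extChartAt_source_mem_nhds (I := 𝓡 n) (1 : G))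
  have hcont : ContinuousAt (fun p : G × EuclideanSpace ℝ (Fin n) =>
      p.1 * (unitChart n G).symm p.2) (1, unitCoord n G) :=
    continuousAt_fst.mul (ContinuousAt.comp (f := Prod.snd) (g := (unitChart n G).symm)
      continuousAt_unitChart_symm continuousAt_snd)
  -- Here the whole translate gS has to stay inside the chart ball of radius η₃, since its volume is
  -- now bounded from below.
  have hsrc : ∀ᶠ p : G × EuclideanSpace ℝ (Fin n) in 𝓝 (1, unitCoord n G),
      p.1 * (unitChart n G).symm p.2 ∈ (unitChart n G) ⁻¹' Metric.ball (unitCoord n G) η₃ ∩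
        (unitChart n G).source := by
    apply hcont.eventually_mem
    rw [unitChart_symm_unitCoord, mul_one]
    exact inter_mem
      (continuousAt_unitChart.preimage_mem_nhds (Metric.ball_mem_nhds _ hη₃))
      (extChartAt_source_mem_nhds (I := 𝓡 n) (1 : G))
  rw [nhds_prod_eq] at hsrc
  obtain ⟨A, hA, B, hB, hAB⟩ := mem_prod_iff.1 hsrc
  obtain ⟨η₂, hη₂, hη₂B⟩ := Metric.mem_nhds_iff.1 hB
  obtain ⟨W, hW, hWo, hW1⟩ := mem_nhds_iff.1 (inter_mem hWn hA)
  refine ⟨min η₁ η₂, lt_min hη₁ hη₂, μ W / 2, volume (Metric.ball (unitCoord n G) η₃),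
    ?_, measure_ball_lt_top.ne, fun S hS hSo => ?_⟩
  · simp [(hWo.measure_pos μ ⟨1, hW1⟩).ne']
  have hZ : MeasurableSet (translatePairs W η₃ S) :=
    (isOpen_translatePairs hWo hη₃t hSo).measurableSet
  -- The same double integral with the inequalities reversed: the slice over g ∈ W contains gS, of
  -- volume at least half that of S, and the slice over y is contained in y S⁻¹.
  calc μ W / 2 * volume S = ∫⁻ g in W, ((1 / 2 : ℝ≥0) : ℝ≥0∞) * volume S ∂μ := by
        rw [setLIntegral_const, ENNReal.div_eq_inv_mul]
        simp
        ring
    _ ≤ ∫⁻ g in W, volume (Prod.mk g ⁻¹' translatePairs W η₃ S) ∂μ := by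
        refine setLIntegral_mono' hWo.measurableSet fun g hg => ?_
        have hgW := (hW hg).1
        refine (hε S _ ((happ _ hgW.1).mono_set
          (hS.trans (Metric.ball_subset_ball (min_le_left _ _))))).trans (measure_mono ?_)
        rintro _ ⟨s, hs, rfl⟩
        have hgs : g * (unitChart n G).symm s ∈
            (unitChart n G) ⁻¹' Metric.ball (unitCoord n G) η₃ ∩ (unitChart n G).source := @hAB (g, s) ⟨(hW hg).2,
          hη₂B (Metric.ball_subset_ball (min_le_right _ _) (hS hs))⟩
        rw [← unitChart_mul_eq_chartMul hgW.2]
        refine ⟨⟨hg, hgs.1⟩, s, hs, ?_⟩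
        simp only
        rw [(unitChart n G).left_inv hgs.2, inv_mul_cancel_left]
    _ ≤ ∫⁻ g, volume (Prod.mk g ⁻¹' translatePairs W η₃ S) ∂μ := setLIntegral_le_lintegral _ _
    _ = ∫⁻ y, μ ((fun g => (g, y)) ⁻¹' translatePairs W η₃ S) := by
        rw [← Measure.prod_apply hZ, Measure.prod_apply_symm hZ]
    _ ≤ ∫⁻ y, (Metric.ball (unitCoord n G) η₃).indicator
          (fun _ => μ ((unitChart n G).symm '' S)⁻¹) y := by
        refine lintegral_mono fun y => ?_
        by_cases hy : y ∈ Metric.ball (unitCoord n G) η₃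
        · rw [indicator_of_mem hy,
            ← measure_smul μ ((unitChart n G).symm y) ((unitChart n G).symm '' S)⁻¹]
          refine measure_mono fun g hg => ?_
          rw [mem_smul_set_iff_inv_smul_mem, Set.mem_inv]
          simpa using hg.2
        · rw [indicator_of_notMem hy]
          refine (measure_mono_null (t := ∅) ?_ measure_empty).le
          exact fun g hg => hy hg.1.2
    _ = volume (Metric.ball (unitCoord n G) η₃) * μ ((unitChart n G).symm '' S)⁻¹ := by
        rw [lintegral_indicator_const measurableSet_ball, mul_comm]

end Comparison

/-! ### Dilates of open sets and balls -/

section Dilates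

variable {n : ℕ} {G : Type*} [Group G] [TopologicalSpace G]
  [ChartedSpace (EuclideanSpace ℝ (Fin n)) G]

theorem Dilations.dil_image_dil_image (D : Dilations n G) (r s : {r : ℝ // 0 < r}) (A : Set G) :
    D.dil r '' (D.dil s '' A) = D.dil (r * s) '' A := by
  rw [image_image, map_mul]
  rfl

theorem Dilations.isOpen_dil_image (D : Dilations n G) (r : {r : ℝ // 0 < r}) {A : Set G}
    (hA : IsOpen A) : IsOpen (D.dil r '' A) := by
  have : D.dil r '' A = D.dil r⁻¹ ⁻¹' A := by
    rw [map_inv, MulAut.inv_def]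
    exact (D.dil r).toEquiv.image_eq_preimage_symm A
  rw [this]
  exact hA.preimage (D.continuous_dil_apply _)

variable {D : Dilations n G}

theorem HomogeneousNorm.dil_image_ball (N : HomogeneousNorm D) (t : {r : ℝ // 0 < r}) (r : ℝ) :
    D.dil t '' N.ball 1 r = N.ball 1 (t * r) := by
  ext x
  constructor
  · rintro ⟨y, hy, rfl⟩
    rw [N.mem_ball_one, N.dil]
    exact mul_lt_mul_of_pos_left (N.mem_ball_one.1 hy) t.2
  · intro hx
    have e : D.dil t (D.dil t⁻¹ x) = x := by rw [← MulAut.mul_apply, ← map_mul]; simp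
    refine ⟨D.dil t⁻¹ x, N.mem_ball_one.2 ?_, e⟩
    have h := N.mem_ball_one.1 hx
    rw [← e, N.dil] at h
    exact lt_of_mul_lt_mul_left h t.2.le

theorem HomogeneousNorm.isOpen_ball_one (N : HomogeneousNorm D) (r : ℝ) : IsOpen (N.ball 1 r) := by
  have : N.ball 1 r = N.toFun ⁻¹' Iio r := by
    ext x
    exact N.mem_ball_one
  rw [this]
  exact isOpen_Iio.preimage N.continuous_toFun

theorem HomogeneousNorm.measure_ball_lt_top [MeasurableSpace G] (μ : Measure G) [μ.IsHaarMeasure] [LieGroup (𝓡 n) ∞ G]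
    [ConnectedSpace G] [T2Space G] (N : HomogeneousNorm D) (r : ℝ) : μ (N.ball 1 r) < ⊤ := by
  obtain ⟨K, hK, h⟩ := N.exists_isCompact_ball_subset r
  exact (measure_mono h).trans_lt hK.measure_lt_top

theorem HomogeneousNorm.measure_ball_pos [MeasurableSpace G] (μ : Measure G) [μ.IsHaarMeasure] (N : HomogeneousNorm D) {r : ℝ}
    (hr : 0 < r) : 0 < μ (N.ball 1 r) :=
  (N.isOpen_ball_one r).measure_pos μ ⟨1, N.mem_ball_one.2 (by rwa [(N.eq_zero_iff 1).2 rfl])⟩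

end Dilates

/-! ### Dilations scale Haar measure by r^ρ -/

section Scaling

variable {n : ℕ} {G : Type*} [Group G] [TopologicalSpace G]
  [ChartedSpace (EuclideanSpace ℝ (Fin n)) G] [MeasurableSpace G] [BorelSpace G] (μ : Measure G)

/-- A dilation multiplies Haar measure by a constant. -/
theorem Dilations.exists_measure_dil_image [μ.IsHaarMeasure] [LieGroup (𝓡 n) ∞ G]
    (D : Dilations n G) (r : {r : ℝ // 0 < r}) :
    ∃ c : ℝ≥0, ∀ A, IsOpen A → μ (D.dil r '' A) = c * μ A := by
  have : IsTopologicalGroup G := topologicalGroup_of_lieGroup (𝓡 n) ∞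
  have : LocallyCompactSpace G := ChartedSpace.locallyCompactSpace (EuclideanSpace ℝ (Fin n)) G
  -- The push-forward under an automorphism that is a homeomorphism is again Haar, so uniqueness up
  -- to a scalar supplies c.
  have : (μ.map (D.dil r).symm).IsHaarMeasure := by
    refine (D.dil r).symm.isHaarMeasure_map μ ?_ (D.continuous_dil_apply r)
    have h := D.continuous_dil_apply r⁻¹
    rwa [map_inv, MulAut.inv_def] at h
  refine ⟨Measure.haarScalarFactor (μ.map (D.dil r).symm) μ, fun A hA => ?_⟩
  have hc : Continuous (D.dil r).symm := by
    have h := D.continuous_dil_apply r⁻¹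
    rwa [map_inv, MulAut.inv_def] at h
  have h := Measure.measure_isHaarMeasure_eq_smul_of_isOpen (μ.map (D.dil r).symm) μ hA
  rw [Measure.map_apply hc.measurable hA.measurableSet] at h
  have e : D.dil r '' A = (D.dil r).symm ⁻¹' A := (D.dil r).toEquiv.image_eq_preimage_symm A
  rw [e, h]
  rfl

/-- For small `r`, the dilation `δ_r` multiplies Haar measure by `r ^ ρ`. -/
theorem Dilations.measure_dil_image_of_norm_le [μ.IsHaarMeasure] [LieGroup (𝓡 n) ∞ G]
    [SecondCountableTopology G] (D : Dilations n G) {r : {r : ℝ // 0 < r}}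
    (hr : ‖D.differential r‖ ≤ 1 / 4) {A : Set G} (hA : IsOpen A) :
    μ (D.dil r '' A) = ENNReal.ofReal ((r : ℝ) ^ D.homogeneousDim) * μ A := by
  have : IsTopologicalGroup G := topologicalGroup_of_lieGroup (𝓡 n) ∞
  have : LocallyCompactSpace G := ChartedSpace.locallyCompactSpace (EuclideanSpace ℝ (Fin n)) G
  obtain ⟨c, hc⟩ := D.exists_measure_dil_image μ r
  have hpow : ∀ (X : Set G), IsOpen X → ∀ k : ℕ,
      μ (D.dil (r ^ k) '' X)⁻¹ = (c : ℝ≥0∞) ^ k * μ X⁻¹ := by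
    intro X hX k
    have hinv : ∀ k, (D.dil (r ^ k) '' X)⁻¹ = D.dil (r ^ k) '' X⁻¹ := fun k =>
      (image_inv (D.dil (r ^ k)) X).symm
    rw [hinv]
    induction k with
    | zero => simp
    | succ k ih =>
      rw [pow_succ', ← D.dil_image_dil_image, hc _ (D.isOpen_dil_image _ hX.inv), ih,
        pow_succ', mul_assoc]
  have hdet : ENNReal.ofReal |(D.differential r).det| =
      ((Real.toNNReal ((r : ℝ) ^ D.homogeneousDim) : ℝ≥0) : ℝ≥0∞) := by
    rw [D.det_differential, abs_of_pos (Real.rpow_pos_of_pos r.2 _)]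
    rfl
  -- a small ball on which everything is under control, and the images of it
  have key : ∀ {ε : ℝ≥0}, 0 < ε → ∀ η₁ > 0, ∃ S : ℕ → Set (EuclideanSpace ℝ (Fin n)),
      (∀ k, S k ⊆ Metric.ball (unitCoord n G) η₁) ∧
      (∀ k, IsOpen ((unitChart n G).symm '' S k)) ∧
      (∀ k, S (k + 1) = D.chartDil r '' S k) ∧
      (∀ k, ApproximatesLinearOn (D.chartDil r) (D.differential r) (S k) ε) ∧
      volume (S 0) ≠ 0 ∧ volume (S 0) ≠ ⊤ ∧
      (∀ k, μ ((unitChart n G).symm '' S k)⁻¹ =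
        (c : ℝ≥0∞) ^ k * μ ((unitChart n G).symm '' S 0)⁻¹) ∧
      μ ((unitChart n G).symm '' S 0)⁻¹ ≠ 0 := by
    intro ε hε η₁ hη₁
    obtain ⟨η₀, hη₀, h⟩ := D.exists_ball_contraction hr hε
    have hη : 0 < min η₀ η₁ := lt_min hη₀ hη₁
    obtain ⟨ht, happ, h1, h2⟩ := h (min η₀ η₁) hη (min_le_left _ _)
    set b := Metric.ball (unitCoord n G) (min η₀ η₁) with hb
    have hit := fun {x} (hx : x ∈ b) k => D.iterate_chartDil h1 h2 hx k
    have hsub : ∀ k, (D.chartDil r)^[k] '' b ⊆ b := by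
      rintro k _ ⟨x, hx, rfl⟩
      exact (hit hx k).1
    have himg : ∀ k, (unitChart n G).symm '' ((D.chartDil r)^[k] '' b) =
        D.dil (r ^ k) '' ((unitChart n G).symm '' b) := by
      intro k
      rw [image_image, image_image]
      exact image_congr fun x hx => (hit hx k).2.2
    have hbo : IsOpen ((unitChart n G).symm '' b) := by
      rw [(unitChart n G).symm_image_eq_source_inter_preimage ht]
      exact isOpen_extChartAt_preimage' (I := 𝓡 n) (1 : G) Metric.isOpen_ball
    refine ⟨fun k => (D.chartDil r)^[k] '' b, fun k => (hsub k).trans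
      (Metric.ball_subset_ball (min_le_right _ _)), fun k => ?_, fun k => ?_, fun k => ?_, ?_, ?_,
      fun k => ?_, ?_⟩
    · simp only [himg]
      exact D.isOpen_dil_image _ hbo
    · simp only [Function.iterate_succ', image_comp]
    · exact happ.mono_set (hsub k)
    · simpa using (Metric.measure_ball_pos volume _ hη).ne'
    · simpa using measure_ball_lt_top.ne
    · simp only [himg]
      rw [hpow _ hbo, hpow _ hbo]
      simp
    · have : ((unitChart n G).symm '' ((D.chartDil r)^[0] '' b)) =
        ((unitChart n G).symm '' b) := by simp
      simp only [this]
      exact (hbo.inv.measure_pos μ (by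
        rw [Set.nonempty_inv]
        exact ⟨_, mem_image_of_mem _ (Metric.mem_ball_self hη)⟩)).ne'
  -- For each M > r^ρ (resp. m < r^ρ) the ball is taken so small that δ_r multiplies volumes by at
  -- most M (resp. at least m). Comparing c^k with M^k or m^k, up to factors independent of k, gives
  -- both inequalities.
  have hcd : c = Real.toNNReal ((r : ℝ) ^ D.homogeneousDim) := by
    apply le_antisymm
    · refine le_of_forall_gt_imp_ge_of_dense fun M hM => ?_
      obtain ⟨ε, hε, hεpos⟩ := ((addHaar_image_le_mul_of_det_lt volume (D.differential r) (m := M)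
        (by rw [hdet]; exact_mod_cast hM)).and self_mem_nhdsWithin).exists
      obtain ⟨η₁, hη₁, c₁, C₁, hc₁, hC₁, hle⟩ := exists_haar_inv_le_volume (n := n) μ
      obtain ⟨S, hS, hSo, hSs, hSa, hS0, hS1, hSμ, hSμ0⟩ := key hεpos η₁ hη₁
      have hv : ∀ k, volume (S k) ≤ (M : ℝ≥0∞) ^ k * volume (S 0) := by
        intro k
        induction k with
        | zero => simp
        | succ k ih =>
          rw [hSs, pow_succ', mul_assoc]
          exact (hε _ _ (hSa k)).trans (by gcongr)
      refine ENNReal.le_of_forall_mul_pow_le (mul_ne_zero hc₁ hSμ0) (ENNReal.mul_ne_top hC₁ hS1)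
        fun k => ?_
      calc c₁ * μ ((unitChart n G).symm '' S 0)⁻¹ * (c : ℝ≥0∞) ^ k
          = c₁ * μ ((unitChart n G).symm '' S k)⁻¹ := by rw [hSμ k]; ring
        _ ≤ C₁ * volume (S k) := hle _ (hS k) (hSo k)
        _ ≤ C₁ * ((M : ℝ≥0∞) ^ k * volume (S 0)) := by gcongr; exact hv k
        _ = C₁ * volume (S 0) * (M : ℝ≥0∞) ^ k := by ring
    · refine le_of_forall_lt_imp_le_of_dense fun m hm => ?_
      obtain ⟨ε, hε, hεpos⟩ := ((mul_le_addHaar_image_of_lt_det volume (D.differential r) (m := m)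
        (by rw [hdet]; exact_mod_cast hm)).and self_mem_nhdsWithin).exists
      obtain ⟨η₁, hη₁, c₁, C₁, hc₁, hC₁, hle⟩ := exists_volume_le_haar_inv (n := n) μ
      obtain ⟨η₂, hη₂, c₂, C₂, hc₂, hC₂, hle₂⟩ := exists_haar_inv_le_volume (n := n) μ
      obtain ⟨S, hS, hSo, hSs, hSa, hS0, hS1, hSμ, hSμ0⟩ :=
        key hεpos (min η₁ η₂) (lt_min hη₁ hη₂)
      have hv : ∀ k, (m : ℝ≥0∞) ^ k * volume (S 0) ≤ volume (S k) := by
        intro k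
        induction k with
        | zero => simp
        | succ k ih =>
          rw [hSs, pow_succ', mul_assoc]
          exact le_trans (by gcongr) (hε _ _ (hSa k))
      -- The lower bound needs a finite Haar measure on the right-hand side; the opposite comparison
      -- provides it.
      have hfin : μ ((unitChart n G).symm '' S 0)⁻¹ ≠ ⊤ := by
        intro h
        have h2 := hle₂ _ ((hS 0).trans (Metric.ball_subset_ball (min_le_right _ _))) (hSo 0)
        rw [h, ENNReal.mul_top hc₂, top_le_iff] at h2
        exact ENNReal.mul_ne_top hC₂ hS1 h2
      refine ENNReal.le_of_forall_mul_pow_le (mul_ne_zero hc₁ hS0) (ENNReal.mul_ne_top hC₁ hfin)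
        fun k => ?_
      calc c₁ * volume (S 0) * (m : ℝ≥0∞) ^ k
          = c₁ * ((m : ℝ≥0∞) ^ k * volume (S 0)) := by ring
        _ ≤ c₁ * volume (S k) := by gcongr; exact hv k
        _ ≤ C₁ * μ ((unitChart n G).symm '' S k)⁻¹ :=
          hle _ ((hS k).trans (Metric.ball_subset_ball (min_le_left _ _))) (hSo k)
        _ = C₁ * μ ((unitChart n G).symm '' S 0)⁻¹ * (c : ℝ≥0∞) ^ k := by rw [hSμ k]; ring
  rw [hc A hA, hcd]
  rfl

/-- The dilation `δ_r` multiplies Haar measure by `r ^ ρ`. -/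
theorem Dilations.measure_dil_image [μ.IsHaarMeasure] [LieGroup (𝓡 n) ∞ G]
    [SecondCountableTopology G] (D : Dilations n G) (r : {r : ℝ // 0 < r}) {A : Set G}
    (hA : IsOpen A) :
    μ (D.dil r '' A) = ENNReal.ofReal ((r : ℝ) ^ D.homogeneousDim) * μ A := by
  obtain ⟨r₀, hr₀, hd⟩ := D.exists_norm_differential_le (ε := 1 / 4) (by norm_num)
  -- Chosen so that both t and r t are small; then δ_r = δ_(rt) δ_t⁻¹ reduces any r to the small
  -- case.
  let t : {r : ℝ // 0 < r} := ⟨min (r₀ / 2) (r₀ / 2 / r), lt_min (by positivity)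
    (div_pos (by positivity) r.2)⟩
  have ht : ‖D.differential t‖ ≤ 1 / 4 :=
    hd t ((min_le_left _ _).trans_lt (half_lt_self hr₀))
  have hrt : ‖D.differential (r * t)‖ ≤ 1 / 4 := by
    refine hd (r * t) ?_
    have h1 : (r : ℝ) * min (r₀ / 2) (r₀ / 2 / r) ≤ r * (r₀ / 2 / r) :=
      mul_le_mul_of_nonneg_left (min_le_right _ _) r.2.le
    have h2 : (r : ℝ) * (r₀ / 2 / r) = r₀ / 2 := by
      have := r.2.ne'
      field_simp
    exact (h1.trans_eq h2).trans_lt (half_lt_self hr₀)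
  have hA' : IsOpen (D.dil t⁻¹ '' A) := D.isOpen_dil_image _ hA
  have e1 : D.dil t '' (D.dil t⁻¹ '' A) = A := by
    rw [D.dil_image_dil_image, mul_inv_cancel, map_one]
    simp
  have e2 : D.dil (r * t) '' (D.dil t⁻¹ '' A) = D.dil r '' A := by
    rw [D.dil_image_dil_image, mul_assoc, mul_inv_cancel, mul_one]
  have m1 := D.measure_dil_image_of_norm_le μ ht hA'
  have m2 := D.measure_dil_image_of_norm_le μ hrt hA'
  rw [e1] at m1
  rw [e2] at m2
  rw [m1, m2, ← mul_assoc, ← ENNReal.ofReal_mul (Real.rpow_nonneg r.2.le _)]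
  congr 2
  exact Real.mul_rpow r.2.le t.2.le

variable {D : Dilations n G}

/-- Homogeneous balls of radius `r` have measure proportional to `r ^ ρ`. -/
theorem HomogeneousNorm.measure_ball_mul [μ.IsHaarMeasure] [LieGroup (𝓡 n) ∞ G]
    [SecondCountableTopology G] (N : HomogeneousNorm D) {t : ℝ} (ht : 0 < t) (r : ℝ) :
    μ (N.ball 1 (t * r)) = ENNReal.ofReal (t ^ D.homogeneousDim) * μ (N.ball 1 r) := by
  rw [← D.measure_dil_image μ ⟨t, ht⟩ (N.isOpen_ball_one r), N.dil_image_ball]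

end Scaling

/-! ### Means over the cells of a measurable partition -/

section Cells

variable {X : Type*}

/-- The `ℓ^p` norm of a family indexed by the members of a set of sets. -/
noncomputable def cellSum (P : Set (Set X)) (p : ℝ≥0∞) (a : P → ℝ≥0∞) : ℝ≥0∞ :=
  if p = ⊤ then ⨆ E : P, a E else (∑' E : P, a E ^ p.toReal) ^ (1 / p.toReal)

theorem cellSum_mono {P : Set (Set X)} {p : ℝ≥0∞} {a b : P → ℝ≥0∞} (h : ∀ E, a E ≤ b E) :
    cellSum P p a ≤ cellSum P p b := by
  unfold cellSum
  split_ifs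
  · exact iSup_mono h
  · gcongr with E
    exact h E

theorem cellSum_const_mul {P : Set (Set X)} {p : ℝ≥0∞} (hp : p ≠ 0) (c : ℝ≥0∞)
    (a : P → ℝ≥0∞) : cellSum P p (fun E => c * a E) = c * cellSum P p a := by
  unfold cellSum
  split_ifs with h
  · rw [ENNReal.mul_iSup]
  · have hp0 : 0 < p.toReal := ENNReal.toReal_pos hp h
    simp_rw [ENNReal.mul_rpow_of_nonneg _ _ hp0.le]
    rw [ENNReal.tsum_mul_left, ENNReal.mul_rpow_of_nonneg _ _ (by positivity), ← ENNReal.rpow_mul,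
      mul_one_div_cancel hp0.ne', ENNReal.rpow_one]

theorem iUnion_coe_eq_univ {P : Set (Set X)} (hP : Setoid.IsPartition P) :
    ⋃ E : P, (E : Set X) = univ := by
  rw [← sUnion_eq_iUnion, hP.sUnion_eq_univ]

theorem pairwise_disjoint_coe {P : Set (Set X)} (hP : Setoid.IsPartition P) :
    Pairwise (Function.onFun Disjoint fun E : P => (E : Set X)) := fun E F h =>
  hP.pairwiseDisjoint E.2 F.2 fun h' => h (Subtype.ext h')

/-- The cell containing `x`. -/
def cellOf (P : Set (Set X)) (x : X) : Set X := ⋃₀ {E ∈ P | x ∈ E}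

theorem cellOf_eq {P : Set (Set X)} (hP : Setoid.IsPartition P) {E : Set X} (hE : E ∈ P) {x : X}
    (hx : x ∈ E) : cellOf P x = E := by
  have : {F ∈ P | x ∈ F} = {E} := by
    ext F
    refine ⟨fun h => (hP.2 x).unique h ⟨hE, hx⟩, ?_⟩
    rintro rfl
    exact ⟨hE, hx⟩
  rw [cellOf, this, sUnion_singleton]

variable [MeasurableSpace X] {μ : Measure X}

/-- A countable measurable partition into cells of positive finite measure. -/
structure IsCellPartition (μ : Measure X) (P : Set (Set X)) : Prop where
  isPartition : Setoid.IsPartition P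
  countable : P.Countable
  measurableSet : ∀ E ∈ P, MeasurableSet E
  measure_ne_zero : ∀ E ∈ P, μ E ≠ 0
  measure_ne_top : ∀ E ∈ P, μ E ≠ ⊤

/-- The `L^p` norm is the `ℓ^p` norm of the `L^p` norms over the cells. -/
theorem IsCellPartition.eLpNorm_eq_cellSum {P : Set (Set X)} (hP : IsCellPartition μ P)
    {ε : Type*} [ENorm ε] {p : ℝ≥0∞} (hp : p ≠ 0) (f : X → ε) :
    eLpNorm f p μ = cellSum P p fun E => eLpNorm f p (μ.restrict E) := by
  have : Countable P := hP.countable.to_subtype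
  unfold cellSum
  split_ifs with h
  · subst h
    simp only [eLpNorm_exponent_top]
    apply le_antisymm
    · refine essSup_le_of_ae_le _ ?_
      change ∀ᵐ x ∂μ, ‖f x‖ₑ ≤ _
      rw [← Measure.restrict_univ (μ := μ), ← iUnion_coe_eq_univ hP.isPartition,
        ae_restrict_iUnion_iff]
      intro E
      rw [iUnion_coe_eq_univ hP.isPartition, Measure.restrict_univ]
      filter_upwards [ae_le_eLpNormEssSup (μ := μ.restrict E) (f := f)] with x hx
      exact hx.trans (le_iSup (fun E : P => eLpNormEssSup f (μ.restrict E)) E)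
    · refine iSup_le fun E => ?_
      have hac : μ.restrict (E : Set X) ≪ μ :=
        Measure.absolutelyContinuous_of_le Measure.restrict_le_self
      exact essSup_mono_measure hac
  · have hp0 : 0 < p.toReal := ENNReal.toReal_pos hp h
    simp_rw [eLpNorm_eq_lintegral_rpow_enorm_toReal hp h]
    simp_rw [← ENNReal.rpow_mul, one_div_mul_cancel hp0.ne', ENNReal.rpow_one]
    rw [← lintegral_iUnion (fun E : P => hP.measurableSet E E.2)
      (pairwise_disjoint_coe hP.isPartition), iUnion_coe_eq_univ hP.isPartition,
      Measure.restrict_univ]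

/-- The `L^q` mean of `f` over the cell containing `x`. -/
noncomputable def cellMean (μ : Measure X) (P : Set (Set X)) (q : ℝ≥0∞) (f : X → ℂ) (x : X) :
    ℝ≥0∞ :=
  eLpNorm f q (cond μ (cellOf P x))

/-- `cond` is restriction divided by the mass of the cell; for finite q this normalisation comes out
of the norm as μ(E)^(-1/q). -/
theorem IsCellPartition.cellMean_eq {P : Set (Set X)} (hP : IsCellPartition μ P) {q : ℝ≥0∞}
    (hq : q ≠ ⊤) (f : X → ℂ) {E : Set X} (hE : E ∈ P) {x : X} (hx : x ∈ E) :
    cellMean μ P q f x = (μ E) ^ (-q⁻¹.toReal) * eLpNorm (E.indicator f) q μ := by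
  rw [cellMean, cellOf_eq hP.isPartition hE hx, ProbabilityTheory.cond,
    eLpNorm_smul_measure_of_ne_top hq, smul_eq_mul,
    eLpNorm_indicator_eq_eLpNorm_restrict (hP.measurableSet E hE), one_div,
    ENNReal.inv_rpow, ENNReal.rpow_neg]

theorem IsCellPartition.exists_mem {P : Set (Set X)} (hP : IsCellPartition μ P) (x : X) :
    ∃ E ∈ P, x ∈ E := (hP.isPartition.2 x).exists

theorem IsCellPartition.measurable_cellMean {P : Set (Set X)} (hP : IsCellPartition μ P)
    (q : ℝ≥0∞) (f : X → ℂ) : Measurable (cellMean μ P q f) := by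
  intro t _
  -- The mean is constant on cells, so every preimage is a countable union of cells.
  have : cellMean μ P q f ⁻¹' t = ⋃ E ∈ {E ∈ P | E ⊆ cellMean μ P q f ⁻¹' t}, E := by
    ext x
    simp only [mem_iUnion, exists_prop]
    refine ⟨fun hx => ?_, fun ⟨E, hE, hx⟩ => hE.2 hx⟩
    obtain ⟨E, hE, hxE⟩ := hP.exists_mem x
    refine ⟨E, ⟨hE, fun y hy => ?_⟩, hxE⟩
    have : cellMean μ P q f y = cellMean μ P q f x := by
      rw [cellMean, cellMean, cellOf_eq hP.isPartition hE hxE, cellOf_eq hP.isPartition hE hy]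
    rw [mem_preimage, this]
    exact hx
  rw [this]
  exact MeasurableSet.biUnion (hP.countable.mono (sep_subset _ _))
    fun E hE => hP.measurableSet E hE.1

/-- The `L^p` norm of the cell means is controlled by the partition norm. -/
theorem IsCellPartition.eLpNorm_cellMean_le {P : Set (Set X)} (hP : IsCellPartition μ P)
    {q p K : ℝ≥0∞} (hq : q ≠ ⊤) (hp : p ≠ 0)
    (hK : ∀ E ∈ P, μ E ^ (p⁻¹.toReal - q⁻¹.toReal) ≤ K) (f : X → ℂ) :
    eLpNorm (cellMean μ P q f) p μ ≤
      K * cellSum P p fun E => eLpNorm ((E : Set X).indicator f) q μ := by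
  rw [hP.eLpNorm_eq_cellSum hp, ← cellSum_const_mul hp]
  refine cellSum_mono fun E => ?_
  have hE0 := hP.measure_ne_zero E E.2
  have h1 : eLpNorm (cellMean μ P q f) p (μ.restrict E) =
      eLpNorm (fun _ : X => (μ E) ^ (-q⁻¹.toReal) * eLpNorm ((E : Set X).indicator f) q μ) p
        (μ.restrict E) := by
    refine eLpNorm_congr_enorm_ae ?_
    filter_upwards [ae_restrict_mem (hP.measurableSet E E.2)] with x hx
    rw [hP.cellMean_eq hq f E.2 hx]
  rw [h1, eLpNorm_const _ hp (by simpa using hE0), Measure.restrict_apply_univ, enorm_eq_self]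
  -- The power -1/q comes from averaging, the power 1/p from the L^p norm of a constant on E.
  calc μ E ^ (-q⁻¹.toReal) * eLpNorm ((E : Set X).indicator f) q μ * μ E ^ (1 / p.toReal)
      = μ E ^ (p⁻¹.toReal - q⁻¹.toReal) * eLpNorm ((E : Set X).indicator f) q μ := by
        rw [sub_eq_add_neg, ENNReal.rpow_add _ _ hE0 (hP.measure_ne_top E E.2), ENNReal.toReal_inv p,
          one_div]
        ring
    _ ≤ _ := by gcongr; exact hK E E.2

/-- For p = q the powers of μ(E) cancel. This contraction property allows the passage from
continuous functions to L^q by density. -/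
theorem IsCellPartition.eLpNorm_cellMean_le_self {P : Set (Set X)} (hP : IsCellPartition μ P)
    {q : ℝ≥0∞} (hq : q ≠ ⊤) (hq0 : q ≠ 0) (f : X → ℂ) :
    eLpNorm (cellMean μ P q f) q μ ≤ eLpNorm f q μ := by
  refine (hP.eLpNorm_cellMean_le (K := 1) hq hq0 (fun E _ => by simp) f).trans_eq ?_
  rw [one_mul, hP.eLpNorm_eq_cellSum hq0 f]
  congr 1
  funext E
  exact eLpNorm_indicator_eq_eLpNorm_restrict (hP.measurableSet E E.2)

theorem cellMean_mono {P : Set (Set X)} {q : ℝ≥0∞} {f g : X → ℂ} (h : ∀ x, ‖f x‖ ≤ ‖g x‖)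
    (x : X) : cellMean μ P q f x ≤ cellMean μ P q g x :=
  eLpNorm_mono h

theorem abs_toReal_eLpNorm_sub_le {ν : Measure X} {q : ℝ≥0∞} (hq : 1 ≤ q) {f g : X → ℂ}
    (hf : MemLp f q ν) (hg : MemLp g q ν) :
    |(eLpNorm f q ν).toReal - (eLpNorm g q ν).toReal| ≤ (eLpNorm (f - g) q ν).toReal := by
  have : Fact (1 ≤ q) := ⟨hq⟩
  rw [← Lp.norm_toLp f hf, ← Lp.norm_toLp g hg, ← Lp.norm_toLp (f - g) (hf.sub hg),
    MemLp.toLp_sub]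
  exact abs_norm_sub_norm_le _ _

theorem MemLp.cond {q : ℝ≥0∞} {f : X → ℂ} (hf : MemLp f q μ) {E : Set X} (hE : μ E ≠ 0) :
    MemLp f q (ProbabilityTheory.cond μ E) :=
  (hf.restrict E).smul_measure (ENNReal.inv_ne_top.2 hE)

theorem IsCellPartition.cellOf_mem {P : Set (Set X)} (hP : IsCellPartition μ P) (x : X) :
    cellOf P x ∈ P := by
  obtain ⟨E, hE, hx⟩ := hP.exists_mem x
  rwa [cellOf_eq hP.isPartition hE hx]

theorem IsCellPartition.mem_cellOf {P : Set (Set X)} (hP : IsCellPartition μ P) (x : X) :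
    x ∈ cellOf P x := by
  obtain ⟨E, hE, hx⟩ := hP.exists_mem x
  rwa [cellOf_eq hP.isPartition hE hx]

/-- If `h` oscillates by at most `δ` on a cell, its mean there is within `δ` of its values. -/
theorem IsCellPartition.abs_cellMean_sub_norm_le {P : Set (Set X)} (hP : IsCellPartition μ P)
    {q : ℝ≥0∞} (hq : 1 ≤ q) {h : X → ℂ} (hh : MemLp h q μ) {δ : ℝ} {x : X}
    (hδ : ∀ y ∈ cellOf P x, ‖h y - h x‖ ≤ δ) :
    |(cellMean μ P q h x).toReal - ‖h x‖| ≤ δ := by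
  have hE := hP.cellOf_mem x
  have := cond_isProbabilityMeasure_of_finite (hP.measure_ne_zero _ hE) (hP.measure_ne_top _ hE)
  have hδ0 : 0 ≤ δ := (norm_nonneg _).trans (hδ x (hP.mem_cellOf x))
  -- Reverse triangle inequality against the constant h x, whose norm for the probability measure on
  -- the cell is ‖h x‖.
  have h1 := abs_toReal_eLpNorm_sub_le hq (MemLp.cond hh (hP.measure_ne_zero _ hE))
    (memLp_const (h x))
  have h2 : (eLpNorm (fun _ : X => h x) q (ProbabilityTheory.cond μ (cellOf P x))).toReal =
      ‖h x‖ := by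
    rw [eLpNorm_const _ (one_pos.trans_le hq).ne' (IsProbabilityMeasure.ne_zero _)]
    simp
  rw [h2] at h1
  refine h1.trans (ENNReal.toReal_le_of_le_ofReal hδ0 ?_)
  have h3 := eLpNorm_le_of_ae_bound (p := q) (C := δ)
    (f := h - fun _ => h x) (μ := ProbabilityTheory.cond μ (cellOf P x)) (by
      filter_upwards [ae_cond_mem (hP.measurableSet _ hE)] with y hy using hδ y hy)
  simpa using h3

end Cells

/-! ### Geometry of the partitions and bounds uniform in r -/

section PartitionFamily

variable {n : ℕ} {G : Type*} [Group G] [TopologicalSpace G]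
  [ChartedSpace (EuclideanSpace ℝ (Fin n)) G] {D : Dilations n G}

theorem HomogeneousNorm.map_one (N : HomogeneousNorm D) : N.toFun 1 = 0 := (N.eq_zero_iff 1).2 rfl

theorem HomogeneousNorm.ball_eq_smul (N : HomogeneousNorm D) (x : G) (r : ℝ) :
    N.ball x r = x • N.ball 1 r := by
  ext y
  rw [mem_smul_set_iff_inv_smul_mem, N.mem_ball_one]
  rfl

/-- The quasi-triangle inequality holds with the constant `γ`, provided it holds with some
constant. -/
theorem HomogeneousNorm.mul_le_gamma (N : HomogeneousNorm D) (h : N.gamma ≠ 0) (x y : G) :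
    N.toFun (x * y) ≤ N.gamma * (N.toFun x + N.toFun y) := by
  set S := {c : ℝ | 0 < c ∧ ∀ x y : G, N.toFun (x * y) ≤ c * (N.toFun x + N.toFun y)} with hS
  have hne : S.Nonempty := by
    -- The infimum of the empty set is 0 by convention, so γ ≠ 0 certifies that some constant works.
    by_contra hne
    rw [not_nonempty_iff_eq_empty] at hne
    apply h
    rw [HomogeneousNorm.gamma, ← hS, hne, Real.sInf_empty]
  have h0 : 0 ≤ N.toFun x + N.toFun y := add_nonneg (N.nonneg x) (N.nonneg y)
  rcases h0.eq_or_lt with h1 | h1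
  · obtain ⟨c, hc⟩ := hne
    have := hc.2 x y
    rw [← h1] at this ⊢
    simpa using this
  · rw [← div_le_iff₀ h1]
    refine le_csInf hne fun c hc => ?_
    rw [div_le_iff₀ h1]
    exact hc.2 x y

/-- Test the quasi-triangle inequality on x ≠ e and y = e. -/
theorem HomogeneousNorm.one_le_gamma [Nontrivial G] (N : HomogeneousNorm D) (h : N.gamma ≠ 0) :
    1 ≤ N.gamma := by
  obtain ⟨x, hx⟩ := exists_ne (1 : G)
  have hpos : 0 < N.toFun x := (N.nonneg x).lt_of_ne fun h => hx ((N.eq_zero_iff x).1 h.symm)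
  have h1 := N.mul_le_gamma h x 1
  rw [mul_one, N.map_one, add_zero] at h1
  exact le_of_mul_le_mul_right (by linarith) hpos

variable [MeasurableSpace G] {N : HomogeneousNorm D} {π : ℝ → Set (Set G)}

/-- If γ were 0, the radius r/(4γ²) would be r/0 = 0 and B empty, yet a nonempty cell must lie in a
translate of B². So the existence of the partitions already entails a quasi-triangle inequality. -/
theorem IsPartitionFamily.gamma_ne_zero (hπ : IsPartitionFamily N π) : N.gamma ≠ 0 := by
  intro h
  obtain ⟨hP, -, hU⟩ := hπ 1 one_pos
  obtain ⟨E, ⟨hE, -⟩, -⟩ := hP.2 1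
  obtain ⟨x, hx, -, hV⟩ := hU E hE
  obtain ⟨y, hy, -⟩ := hV hx
  obtain ⟨u, hu, -⟩ := hy
  rw [h, N.mem_ball_one] at hu
  simp only [ne_eq, OfNat.ofNat_ne_zero, not_false_eq_true, zero_pow, mul_zero, div_zero] at hu
  exact absurd hu (not_lt.2 (N.nonneg u))

/-- A member of `π_r` lies in the ball of radius `r` around each of its points, and contains a
translate of the ball of radius `r / (4 γ²)`. -/
theorem IsPartitionFamily.subset_ball [Nontrivial G] (hπ : IsPartitionFamily N π) {r : ℝ}
    (hr : 0 < r) {E : Set G} (hE : E ∈ π r) {y : G} (hy : y ∈ E) : E ⊆ N.ball y r := by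
  obtain ⟨-, -, hU⟩ := hπ r hr
  obtain ⟨x, hx, -, hV⟩ := hU E hE
  have hγ := hπ.gamma_ne_zero
  have h1 := N.one_le_gamma hγ
  have hpos : 0 < N.gamma := by linarith
  -- One quasi-triangle inequality turns B² into radius r/(2γ) about the centre x of the cell; a
  -- second one, between two points of the cell, gives r. This explains the 4γ².
  have hsmall : ∀ z ∈ E, N.toFun (x⁻¹ * z) < r / (2 * N.gamma) := by
    intro z hz
    obtain ⟨_, ⟨u, hu, v, hv, rfl⟩, rfl⟩ := hV hz
    rw [N.mem_ball_one] at hu hv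
    simp only [smul_eq_mul, inv_mul_cancel_left]
    calc N.toFun (u * v) ≤ N.gamma * (N.toFun u + N.toFun v) := N.mul_le_gamma hγ u v
      _ < N.gamma * (r / (4 * N.gamma ^ 2) + r / (4 * N.gamma ^ 2)) := by gcongr
      _ = r / (2 * N.gamma) := by field_simp; norm_num
  intro z hz
  have e : y⁻¹ * z = (x⁻¹ * y)⁻¹ * (x⁻¹ * z) := by group
  change N.toFun (y⁻¹ * z) < r
  rw [e]
  calc N.toFun ((x⁻¹ * y)⁻¹ * (x⁻¹ * z))
      ≤ N.gamma * (N.toFun (x⁻¹ * y)⁻¹ + N.toFun (x⁻¹ * z)) := N.mul_le_gamma hγ _ _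
    _ = N.gamma * (N.toFun (x⁻¹ * y) + N.toFun (x⁻¹ * z)) := by rw [N.inv]
    _ < N.gamma * (r / (2 * N.gamma) + r / (2 * N.gamma)) := by
        gcongr
        · exact hsmall y hy
        · exact hsmall z hz
    _ = r := by field_simp; norm_num

variable (μ : Measure G) [μ.IsHaarMeasure] [LieGroup (𝓡 n) ∞ G]

theorem IsPartitionFamily.measure_le_ball [Nontrivial G] (hπ : IsPartitionFamily N π) {r : ℝ}
    (hr : 0 < r) {E : Set G} (hE : E ∈ π r) : μ E ≤ μ (N.ball 1 r) := by
  have : IsTopologicalGroup G := topologicalGroup_of_lieGroup (𝓡 n) ∞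
  obtain ⟨y, hy, -⟩ := (hπ r hr).2.2 E hE
  refine (measure_mono (hπ.subset_ball hr hE hy)).trans_eq ?_
  rw [N.ball_eq_smul, measure_smul]

theorem IsPartitionFamily.ball_le_measure (hπ : IsPartitionFamily N π) {r : ℝ}
    (hr : 0 < r) {E : Set G} (hE : E ∈ π r) : μ (N.ball 1 (r / (4 * N.gamma ^ 2))) ≤ μ E := by
  have : IsTopologicalGroup G := topologicalGroup_of_lieGroup (𝓡 n) ∞
  obtain ⟨x, -, hU, -⟩ := (hπ r hr).2.2 E hE
  rw [← measure_smul μ x]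
  exact measure_mono hU

/-- The measure of a member of `π_r` is comparable with the measure of the ball of radius `r`. -/
theorem IsPartitionFamily.ball_le_mul_measure [BorelSpace G] [SecondCountableTopology G]
    (hπ : IsPartitionFamily N π) {r : ℝ} (hr : 0 < r) {E : Set G} (hE : E ∈ π r) :
    μ (N.ball 1 r) ≤ ENNReal.ofReal ((4 * N.gamma ^ 2) ^ D.homogeneousDim) * μ E := by
  have hγ := hπ.gamma_ne_zero
  have hpos : 0 < 4 * N.gamma ^ 2 := by positivity
  have h := N.measure_ball_mul μ hpos (r / (4 * N.gamma ^ 2))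
  rw [mul_div_cancel₀ _ hpos.ne'] at h
  rw [h]
  exact mul_le_mul' le_rfl (hπ.ball_le_measure μ hr hE)

/-- Every cell contains a translated ball, so has positive measure, and only countably many disjoint
sets of positive measure fit in G. -/
theorem IsPartitionFamily.isCellPartition [BorelSpace G] [Nontrivial G] [ConnectedSpace G] [T2Space G]
    (hπ : IsPartitionFamily N π) {r : ℝ} (hr : 0 < r) : IsCellPartition μ (π r) := by
  have : IsTopologicalGroup G := topologicalGroup_of_lieGroup (𝓡 n) ∞
  have : LocallyCompactSpace G := ChartedSpace.locallyCompactSpace (EuclideanSpace ℝ (Fin n)) G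
  have := N.secondCountableTopology
  have hγ := hπ.gamma_ne_zero
  have hpos : ∀ E ∈ π r, 0 < μ E := fun E hE =>
    (N.measure_ball_pos μ (by positivity)).trans_le (hπ.ball_le_measure μ hr hE)
  refine ⟨(hπ r hr).1, ?_, (hπ r hr).2.1, fun E hE => (hpos E hE).ne', fun E hE =>
    ((hπ.measure_le_ball μ hr hE).trans_lt (N.measure_ball_lt_top μ r)).ne⟩
  have h := Measure.countable_meas_pos_of_disjoint_iUnion (μ := μ)
    (fun E : π r => (hπ r hr).2.1 E E.2) (pairwise_disjoint_coe (hπ r hr).1)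
  have hu : {E : π r | 0 < μ (E : Set G)} = univ := eq_univ_of_forall fun E => hpos E E.2
  rw [hu, countable_univ_iff] at h
  exact Set.countable_coe_iff.1 h

/-- The constant in the norm equivalence: `(4 γ²)^(ρ (1/q - 1/p))`. -/
noncomputable def amalgamConst (γ ρ : ℝ) (p q : ℝ≥0∞) : ℝ≥0 :=
  (Real.toNNReal ((4 * γ ^ 2) ^ ρ)) ^ (q⁻¹.toReal - p⁻¹.toReal)

/-- Turns the bound of λ(B_(e,r)) by a multiple of λ(E) into a bound for the power 1/p - 1/q ≤ 0 of
λ(E); this produces the constant C. -/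
theorem ENNReal.rpow_neg_le_mul_rpow_neg {a b d : ℝ≥0∞} (ha : a ≠ 0) (ha' : a ≠ ⊤) (hb : b ≠ 0)
    (hb' : b ≠ ⊤) (h : b ≤ d * a) {e : ℝ} (he : 0 ≤ e) : a ^ (-e) ≤ d ^ e * b ^ (-e) := by
  have h1 : b ^ e ≤ d ^ e * a ^ e := by
    rw [← ENNReal.mul_rpow_of_nonneg _ _ he]
    gcongr
  have hbe : b ^ e * b ^ (-e) = 1 := by
    rw [← ENNReal.rpow_add _ _ hb hb', add_neg_cancel, ENNReal.rpow_zero]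
  have hae : a ^ e * a ^ (-e) = 1 := by
    rw [← ENNReal.rpow_add _ _ ha ha', add_neg_cancel, ENNReal.rpow_zero]
  calc a ^ (-e) = b ^ e * b ^ (-e) * a ^ (-e) := by rw [hbe, one_mul]
    _ ≤ d ^ e * a ^ e * b ^ (-e) * a ^ (-e) := by gcongr
    _ = d ^ e * b ^ (-e) * (a ^ e * a ^ (-e)) := by ring
    _ = d ^ e * b ^ (-e) := by rw [hae, mul_one]

theorem ENNReal.inv_toReal_le_inv_toReal {p q : ℝ≥0∞} (hq : 1 ≤ q) (hqp : q ≤ p) :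
    p⁻¹.toReal ≤ q⁻¹.toReal :=
  ENNReal.toReal_mono (ENNReal.inv_ne_top.2 (one_pos.trans_le hq).ne') (ENNReal.inv_le_inv.2 hqp)

variable [BorelSpace G] [Nontrivial G] [ConnectedSpace G] [T2Space G]

/-- `‖f‖_{q,p,p} ≤ ‖f‖_p`. -/
theorem IsPartitionFamily.fracNorm_le (hπ : IsPartitionFamily N π) {p q : ℝ≥0∞} (hq : 1 ≤ q)
    (hqp : q ≤ p) (f : G →ₘ[μ] ℂ) : fracNorm N μ π q p p f ≤ eLpNorm f p μ := by
  have hp : p ≠ 0 := (one_pos.trans_le (hq.trans hqp)).ne'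
  refine iSup₂_le fun r hr => ?_
  have hP := hπ.isCellPartition μ hr
  have hw0 := (N.measure_ball_pos μ hr).ne'
  have hw1 := (N.measure_ball_lt_top μ r).ne
  change _ * cellSum (π r) p (fun E => eLpNorm ((E : Set G).indicator f) q μ) ≤ _
  rw [← cellSum_const_mul hp, hP.eLpNorm_eq_cellSum hp f]
  refine cellSum_mono fun E => ?_
  rw [eLpNorm_indicator_eq_eLpNorm_restrict (hP.measurableSet E E.2)]
  -- Hölder on the cell. Its factor λ(E)^(1/q - 1/p) is at most the inverse of the weight, as E has
  -- no more measure than the ball of radius r.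
  have h1 := eLpNorm_le_eLpNorm_mul_rpow_measure_univ (μ := μ.restrict (E : Set G)) hqp
    f.aestronglyMeasurable.restrict
  rw [Measure.restrict_apply_univ, one_div, one_div, ← ENNReal.toReal_inv, ← ENNReal.toReal_inv]
    at h1
  have he : 0 ≤ q⁻¹.toReal - p⁻¹.toReal := sub_nonneg.2 (ENNReal.inv_toReal_le_inv_toReal hq hqp)
  calc μ (N.ball 1 r) ^ (p⁻¹.toReal - q⁻¹.toReal) * eLpNorm f q (μ.restrict (E : Set G))
      ≤ μ (N.ball 1 r) ^ (p⁻¹.toReal - q⁻¹.toReal) * (eLpNorm f p (μ.restrict (E : Set G)) *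
          μ (N.ball 1 r) ^ (q⁻¹.toReal - p⁻¹.toReal)) := by
        gcongr
        exact h1.trans
          (mul_le_mul' le_rfl (ENNReal.rpow_le_rpow (hπ.measure_le_ball μ hr E.2) he))
    _ = μ (N.ball 1 r) ^ ((p⁻¹.toReal - q⁻¹.toReal) + (q⁻¹.toReal - p⁻¹.toReal)) *
          eLpNorm f p (μ.restrict (E : Set G)) := by
        rw [ENNReal.rpow_add _ _ hw0 hw1]
        ring
    _ = eLpNorm f p (μ.restrict (E : Set G)) := by
        rw [sub_add_sub_cancel, sub_self, ENNReal.rpow_zero, one_mul]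

/-- The powers λ(E)^(1/p - 1/q) left over from averaging are replaced by the weight λ(B_(e,r))^(1/p
- 1/q) at the cost of C, which does not depend on r. -/
theorem IsPartitionFamily.eLpNorm_cellMean_le_fracNorm (hπ : IsPartitionFamily N π) {p q : ℝ≥0∞}
    (hq : 1 ≤ q) (hqtop : q ≠ ⊤) (hqp : q ≤ p) (f : G →ₘ[μ] ℂ) {r : ℝ} (hr : 0 < r) :
    eLpNorm (cellMean μ (π r) q f) p μ ≤
      amalgamConst N.gamma D.homogeneousDim p q * fracNorm N μ π q p p f := by
  have := N.secondCountableTopology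
  have hp : p ≠ 0 := (one_pos.trans_le (hq.trans hqp)).ne'
  have hP := hπ.isCellPartition μ hr
  have he : 0 ≤ q⁻¹.toReal - p⁻¹.toReal := sub_nonneg.2 (ENNReal.inv_toReal_le_inv_toReal hq hqp)
  refine (hP.eLpNorm_cellMean_le (K := amalgamConst N.gamma D.homogeneousDim p q *
    μ (N.ball 1 r) ^ (p⁻¹.toReal - q⁻¹.toReal)) hqtop hp (fun E hE => ?_) f).trans ?_
  · rw [← neg_sub q⁻¹.toReal, amalgamConst, ENNReal.coe_rpow_of_nonneg _ he]
    exact ENNReal.rpow_neg_le_mul_rpow_neg (hP.measure_ne_zero E hE) (hP.measure_ne_top E hE)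
      (N.measure_ball_pos μ hr).ne' (N.measure_ball_lt_top μ r).ne
      (hπ.ball_le_mul_measure μ hr hE) he
  · rw [mul_assoc]
    gcongr
    exact le_iSup₂ (f := fun (r : ℝ) (_ : 0 < r) =>
      μ (N.ball 1 r) ^ (p⁻¹.toReal - q⁻¹.toReal) * partitionNorm μ (π r) q p f) r hr

end PartitionFamily

/-! ### Convergence of the cell means and the reverse inequality -/

section Convergence

variable {n : ℕ} {G : Type*} [Group G] [TopologicalSpace G]
  [ChartedSpace (EuclideanSpace ℝ (Fin n)) G] {D : Dilations n G}
  [MeasurableSpace G] [BorelSpace G] {N : HomogeneousNorm D} {π : ℝ → Set (Set G)}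
  (μ : Measure G) [μ.IsHaarMeasure] [LieGroup (𝓡 n) ∞ G] [Nontrivial G] [ConnectedSpace G]
  [T2Space G]

/-- The cell means of a continuous compactly supported function converge to its absolute value. -/
theorem IsPartitionFamily.tendsto_cellMean_of_continuous (hπ : IsPartitionFamily N π) {q : ℝ≥0∞}
    (hq : 1 ≤ q) (hqtop : q ≠ ⊤) {h : G → ℂ} (hh : Continuous h) (hc : HasCompactSupport h)
    (hm : MemLp h q μ) :
    Tendsto (fun r => eLpNorm (fun x => (cellMean μ (π r) q h x).toReal - ‖h x‖) q μ)
      (𝓝[>] 0) (𝓝 0) := by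
  have : IsTopologicalGroup G := topologicalGroup_of_lieGroup (𝓡 n) ∞
  have : LocallyCompactSpace G := ChartedSpace.locallyCompactSpace (EuclideanSpace ℝ (Fin n)) G
  obtain ⟨K, hK, hbK⟩ := N.exists_isCompact_ball_subset 1
  -- For r < 1, the cell of a point outside this compact set misses the support of h, so both the
  -- mean and h vanish there.
  have hB : IsCompact (tsupport h * K) := hc.isCompact.mul hK
  rw [ENNReal.tendsto_nhds_zero]
  intro ε hε
  have hfin : μ (tsupport h * K) ^ (1 / q.toReal) ≠ ⊤ :=
    ENNReal.rpow_ne_top_of_nonneg (by positivity) hB.measure_lt_top.ne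
  obtain ⟨δ, hδ, hδε⟩ := ENNReal.exists_nnreal_pos_mul_lt hfin hε.ne'
  have hunif : ∀ᶠ v in 𝓝 (1 : G), ∀ x ∈ tsupport h * K, ‖h (x * v) - h x‖ ≤ δ := by
    refine hB.eventually_forall_of_forall_eventually fun x _ => ?_
    have hcont : Continuous fun z : G × G => ‖h (z.2 * z.1) - h z.2‖ :=
      ((hh.comp (continuous_snd.mul continuous_fst)).sub (hh.comp continuous_snd)).norm
    have h0 : ‖h (x * 1) - h x‖ < (δ : ℝ) := by simpa using hδ
    filter_upwards [(hcont.tendsto ((1 : G), x)).eventually_lt_const h0] with z hz using hz.le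
  obtain ⟨s, hs, hsV, hsc⟩ := local_compact_nhds hunif
  obtain ⟨m, hm0, hms⟩ := N.exists_lt_imp_mem hsc hs
  filter_upwards [Ioo_mem_nhdsGT (lt_min hm0 one_pos)] with r hr
  have hrm : r < m := hr.2.trans_le (min_le_left _ _)
  have hr1 : r < 1 := hr.2.trans_le (min_le_right _ _)
  have hP := hπ.isCellPartition μ hr.1
  have hpt : ∀ x, ‖(cellMean μ (π r) q h x).toReal - ‖h x‖‖ ≤
      ‖(tsupport h * K).indicator (fun _ => (δ : ℝ)) x‖ := by
    intro x
    rw [Real.norm_eq_abs]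
    have hx := hP.mem_cellOf x
    by_cases hxB : x ∈ tsupport h * K
    · rw [indicator_of_mem hxB, Real.norm_of_nonneg δ.coe_nonneg]
      refine hP.abs_cellMean_sub_norm_le hq hm fun y hy => ?_
      have hxy := hπ.subset_ball hr.1 (hP.cellOf_mem x) hx hy
      simpa using hsV (hms _ (lt_trans hxy hrm)) x hxB
    · rw [indicator_of_notMem hxB, norm_zero]
      have hzero : ∀ y ∈ cellOf (π r) x, h y = 0 := by
        intro y hy
        by_contra hne
        apply hxB
        have hyx := hπ.subset_ball hr.1 (hP.cellOf_mem x) hy hx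
        exact ⟨y, subset_tsupport h hne, y⁻¹ * x,
          hbK (N.mem_ball_one.2 (lt_trans hyx hr1)), mul_inv_cancel_left _ _⟩
      refine hP.abs_cellMean_sub_norm_le hq hm fun y hy => ?_
      rw [hzero y hy, hzero x hx]
      simp
  refine (eLpNorm_mono hpt).trans ?_
  rw [eLpNorm_indicator_const hB.measurableSet (one_pos.trans_le hq).ne' hqtop]
  refine le_trans (le_of_eq ?_) hδε.le
  congr 1
  exact NNReal.enorm_eq δ

/-- The cell means of an `L^q` function converge to its absolute value in `L^q`. -/
theorem IsPartitionFamily.tendsto_cellMean (hπ : IsPartitionFamily N π) {q : ℝ≥0∞}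
    (hq : 1 ≤ q) (hqtop : q ≠ ⊤) {g : G → ℂ} (hg : MemLp g q μ) :
    Tendsto (fun r => eLpNorm (fun x => (cellMean μ (π r) q g x).toReal - ‖g x‖) q μ)
      (𝓝[>] 0) (𝓝 0) := by
  have : IsTopologicalGroup G := topologicalGroup_of_lieGroup (𝓡 n) ∞
  have : LocallyCompactSpace G := ChartedSpace.locallyCompactSpace (EuclideanSpace ℝ (Fin n)) G
  have := N.secondCountableTopology
  have hq0 : q ≠ 0 := (one_pos.trans_le hq).ne'
  rw [ENNReal.tendsto_nhds_zero]
  intro ε hε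
  have hε3 : ε / 3 ≠ 0 := (ENNReal.div_pos hε.ne' (by simp)).ne'
  obtain ⟨h, hc, hgh, hh, hhm⟩ := hg.exists_hasCompactSupport_eLpNorm_sub_le hqtop hε3
  filter_upwards [ENNReal.tendsto_nhds_zero.1
    (hπ.tendsto_cellMean_of_continuous μ hq hqtop hh hc hhm) (ε / 3) hε3.bot_lt,
    self_mem_nhdsWithin] with r hr hr0
  have hP := hπ.isCellPartition μ hr0
  have hmeas : ∀ f : G → ℂ, Measurable fun x => (cellMean μ (π r) q f x).toReal := fun f =>
    (hP.measurable_cellMean q f).ennreal_toReal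
  -- The means satisfy |m g - m h| ≤ m(g - h), and averaging contracts the L^q norm.
  have h1 : eLpNorm (fun x => (cellMean μ (π r) q g x).toReal - (cellMean μ (π r) q h x).toReal)
      q μ ≤ ε / 3 := by
    refine le_trans (eLpNorm_mono_enorm (g := cellMean μ (π r) q (g - h)) fun x => ?_)
      ((hP.eLpNorm_cellMean_le_self hqtop hq0 (g - h)).trans hgh)
    have hE := hP.cellOf_mem x
    rw [enorm_eq_self, ← ofReal_norm, Real.norm_eq_abs]
    refine ENNReal.ofReal_le_of_le_toReal ?_
    exact abs_toReal_eLpNorm_sub_le hq (MemLp.cond hg (hP.measure_ne_zero _ hE))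
      (MemLp.cond hhm (hP.measure_ne_zero _ hE))
  have h2 : eLpNorm (fun x => ‖h x‖ - ‖g x‖) q μ ≤ ε / 3 := by
    refine le_trans (eLpNorm_mono fun x => ?_) hgh
    rw [Real.norm_eq_abs, abs_sub_comm]
    exact abs_norm_sub_norm_le _ _
  have hsum : (fun x => (cellMean μ (π r) q g x).toReal - ‖g x‖) =
      (fun x => (cellMean μ (π r) q g x).toReal - (cellMean μ (π r) q h x).toReal) +
        ((fun x => (cellMean μ (π r) q h x).toReal - ‖h x‖) + fun x => ‖h x‖ - ‖g x‖) := by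
    funext x
    simp
  rw [hsum]
  have m2 : AEStronglyMeasurable (fun x => (cellMean μ (π r) q h x).toReal - ‖h x‖) μ :=
    (hmeas h).aestronglyMeasurable.sub hhm.1.norm
  have m3 : AEStronglyMeasurable (fun x => ‖h x‖ - ‖g x‖) μ := hhm.1.norm.sub hg.1.norm
  calc _ ≤ ε / 3 + (ε / 3 + ε / 3) :=
        (eLpNorm_add_le ((hmeas g).sub (hmeas h)).aestronglyMeasurable (m2.add m3) hq).trans
          (add_le_add h1 ((eLpNorm_add_le m2 m3 hq).trans (add_le_add hr h2)))
    _ = ε := by rw [← add_assoc, ENNReal.add_thirds]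

/-- A bound on the `L^p` norms of the cell means bounds the `L^p` norm. -/
theorem IsPartitionFamily.eLpNorm_le_of_cellMean_le (hπ : IsPartitionFamily N π) {p q M : ℝ≥0∞}
    (hq : 1 ≤ q) (hqtop : q ≠ ⊤) {g : G → ℂ} (hg : MemLp g q μ)
    (hM : ∀ r > 0, eLpNorm (cellMean μ (π r) q g) p μ ≤ M) : eLpNorm g p μ ≤ M := by
  have hpos : ∀ j : ℕ, (0 : ℝ) < 1 / (j + 1) := fun j => Nat.one_div_pos_of_nat
  have hlim : Tendsto (fun j : ℕ => (1 : ℝ) / (j + 1)) atTop (𝓝[>] 0) :=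
    tendsto_nhdsWithin_iff.2 ⟨tendsto_one_div_add_atTop_nhds_zero_nat,
      Eventually.of_forall fun j => hpos j⟩
  set u : ℕ → G → ℝ := fun j x => (cellMean μ (π (1 / (j + 1))) q g x).toReal with hu
  have hum : ∀ j, AEStronglyMeasurable (u j) μ := fun j =>
    ((hπ.isCellPartition μ (hpos j)).measurable_cellMean q g).ennreal_toReal.aestronglyMeasurable
  -- L^q convergence gives convergence in measure, hence a.e. along a subsequence; Fatou for the L^p
  -- norm, p = ∞ included, then yields the bound.
  have hmeas : TendstoInMeasure μ u atTop fun x => ‖g x‖ :=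
    tendstoInMeasure_of_tendsto_eLpNorm (one_pos.trans_le hq).ne' hum hg.1.norm
      ((hπ.tendsto_cellMean μ hq hqtop hg).comp hlim)
  obtain ⟨ns, -, hns⟩ := hmeas.exists_seq_tendsto_ae
  have hF := Lp.eLpNorm_lim_le_liminf_eLpNorm (p := p) (fun i => hum (ns i)) _ hns
  rw [eLpNorm_norm] at hF
  refine hF.trans ((liminf_le_liminf (v := fun _ => M) (Eventually.of_forall fun i => ?_)).trans
    (liminf_const M).le)
  refine (eLpNorm_mono_enorm fun x => ?_).trans (hM _ (hpos (ns i)))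
  rw [hu, enorm_eq_self, Real.enorm_of_nonneg ENNReal.toReal_nonneg]
  exact ENNReal.ofReal_toReal_le

/-- The truncation of `f` to the bounded set where `|f| ≤ k` in the ball of radius `k`. -/
noncomputable def truncate (N : HomogeneousNorm D) (f : G → ℂ) (k : ℕ) : G → ℂ :=
  ({x | ‖f x‖ ≤ k} ∩ N.ball 1 k).indicator f

/-- `‖f‖_p ≤ C ‖f‖_{q,p,p}`. -/
theorem IsPartitionFamily.eLpNorm_le (hπ : IsPartitionFamily N π) {p q : ℝ≥0∞} (hq : 1 ≤ q)
    (hqp : q ≤ p) (f : G →ₘ[μ] ℂ) :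
    eLpNorm f p μ ≤ amalgamConst N.gamma D.homogeneousDim p q * fracNorm N μ π q p p f := by
  -- For q = ∞ also p = ∞: all exponents vanish, C = 1, and the single radius r = 1 suffices.
  rcases eq_or_ne q ⊤ with rfl | hqtop
  · have hp : p = ⊤ := top_le_iff.1 hqp
    subst hp
    have hP := hπ.isCellPartition μ one_pos
    have h1 : eLpNorm f ⊤ μ = partitionNorm μ (π 1) ⊤ ⊤ f := by
      rw [hP.eLpNorm_eq_cellSum (by simp)]
      change _ = cellSum (π 1) ⊤ (fun E => eLpNorm ((E : Set G).indicator f) ⊤ μ)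
      congr 1
      funext E
      exact (eLpNorm_indicator_eq_eLpNorm_restrict (hP.measurableSet E E.2)).symm
    have h2 := le_iSup₂ (f := fun (r : ℝ) (_ : 0 < r) => μ (N.ball 1 r) ^
      ((⊤ : ℝ≥0∞)⁻¹.toReal - (⊤ : ℝ≥0∞)⁻¹.toReal) * partitionNorm μ (π r) ⊤ ⊤ f) 1 one_pos
    simp only [sub_self, ENNReal.rpow_zero, one_mul] at h2
    rw [h1, amalgamConst]
    simpa [fracNorm] using h2
  have hball : ∀ k : ℕ, MeasurableSet (N.ball 1 (k : ℝ)) := fun k =>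
    (N.isOpen_ball_one k).measurableSet
  have hset : ∀ k : ℕ, MeasurableSet ({x | ‖f x‖ ≤ k} ∩ N.ball 1 (k : ℝ)) := fun k =>
    (measurableSet_le f.stronglyMeasurable.measurable.norm measurable_const).inter (hball k)
  have htrunc : ∀ k, MemLp (truncate N f k) q μ := by
    intro k
    rw [truncate, memLp_indicator_iff_restrict (hset k)]
    have : IsFiniteMeasure (μ.restrict ({x | ‖f x‖ ≤ k} ∩ N.ball 1 (k : ℝ))) := by
      refine ⟨?_⟩
      rw [Measure.restrict_apply_univ]
      exact (measure_mono inter_subset_right).trans_lt (N.measure_ball_lt_top μ k)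
    refine MemLp.of_bound f.aestronglyMeasurable.restrict k ?_
    filter_upwards [ae_restrict_mem (hset k)] with x hx using hx.1
  have hle : ∀ k x, ‖truncate N f k x‖ ≤ ‖f x‖ := fun k x => norm_indicator_le_norm_self _ _
  -- The truncations lie in L^q, as f itself need not, and their cell means are dominated by those
  -- of f.
  have hbound : ∀ k, eLpNorm (truncate N f k) p μ ≤
      amalgamConst N.gamma D.homogeneousDim p q * fracNorm N μ π q p p f := fun k =>
    hπ.eLpNorm_le_of_cellMean_le μ hq hqtop (htrunc k) fun r hr =>
      (eLpNorm_mono_enorm fun x => cellMean_mono (hle k) x).trans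
        (hπ.eLpNorm_cellMean_le_fracNorm μ hq hqtop hqp f hr)
  have hlim : ∀ x, Tendsto (fun k => truncate N f k x) atTop (𝓝 (f x)) := by
    intro x
    refine tendsto_const_nhds.congr' ?_
    obtain ⟨k₀, hk₀⟩ := exists_nat_gt (max ‖f x‖ (N.toFun x))
    filter_upwards [eventually_ge_atTop k₀] with k hk
    have hk' : (k₀ : ℝ) ≤ k := by exact_mod_cast hk
    rw [truncate, indicator_of_mem]
    exact ⟨(((le_max_left _ _).trans_lt hk₀).le).trans hk',
      N.mem_ball_one.2 (((le_max_right _ _).trans_lt hk₀).trans_le hk')⟩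
  refine (Lp.eLpNorm_lim_le_liminf_eLpNorm (p := p) (fun k => (htrunc k).1) _
    (Eventually.of_forall hlim)).trans ?_
  exact (liminf_le_liminf (v := fun _ => _) (Eventually.of_forall hbound)).trans
    (liminf_const _).le

end Convergence

theorem mainTheorem8 (γ ρ : ℝ) (p q : ℝ≥0∞) (hq : 1 ≤ q) (hqp : q ≤ p) :
    ∃ C : ℝ≥0, ∀ (n : ℕ) (G : Type*) [Group G] [TopologicalSpace G] [T2Space G]
      [ChartedSpace (EuclideanSpace ℝ (Fin n)) G] [LieGroup (𝓡 n) ∞ G]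
      [SimplyConnectedSpace G] [Group.IsNilpotent G] [Nontrivial G]
      [MeasurableSpace G] [BorelSpace G] (μ : Measure G) [μ.IsHaarMeasure]
      (D : Dilations n G) (N : HomogeneousNorm D) (π : ℝ → Set (Set G)),
      D.homogeneousDim = ρ → N.gamma = γ → IsPartitionFamily N π →
      (∀ f : G →ₘ[μ] ℂ,
        fracNorm N μ π q p p f ≤ eLpNorm f p μ ∧
          eLpNorm f p μ ≤ C * fracNorm N μ π q p p f) ∧
      fracSpace N μ π q p p = (Lp ℂ p μ : Set (G →ₘ[μ] ℂ)) := by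
  -- The constant is fixed before n, G and the partitions, so it depends only on γ, ρ, p, q.
  refine ⟨amalgamConst γ ρ p q, ?_⟩
  intro n G _ _ _ _ _ _ _ _ _ _ μ _ D N π hρ hγ hπ
  subst hρ hγ
  have hnorm : ∀ f : G →ₘ[μ] ℂ, fracNorm N μ π q p p f ≤ eLpNorm f p μ ∧
      eLpNorm f p μ ≤ amalgamConst N.gamma D.homogeneousDim p q * fracNorm N μ π q p p f :=
    fun f => ⟨hπ.fracNorm_le μ hq hqp f, hπ.eLpNorm_le μ hq hqp f⟩
  refine ⟨hnorm, ?_⟩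
  ext f
  rw [SetLike.mem_coe, Lp.mem_Lp_iff_eLpNorm_lt_top]
  exact ⟨fun h => (hnorm f).2.trans_lt (ENNReal.mul_lt_top ENNReal.coe_lt_top h),
    fun h => (hnorm f).1.trans_lt h⟩
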